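/- Let $f:L^2(0,\pi)\to L^2(0,\pi)$ be globally Lipschitz with constant $\mathrm{Lip}f$, let $\phi\in H_0^1(0,\pi)$, and consider on $(0,\pi)$ with Dirichlet boundary conditions the damped wave equation $$\epsilon^2\,du_t+(u_t-\Delta u)\,dt=f(u)\,dt+\delta\phi\,dW ,\qquad \delta\ge 0,\tag{W}$$ where $W(t,\omega)=\omega(t)$ is the two-sided Wiener process on the path space $C_0(\mathbb R,\mathbb R)$ with Wiener measure $\mathbb P$ and shift $\theta_t\omega=\omega(t+\cdot)-\omega(t)$. Solutions are curves $U=(u,u_t)$, continuous in $E=H_0^1(0,\pi)\times L^2(0,\pi)$, satisfying (W) pathwise in the weak sense. Let $N\ge 1$, $0<\epsilon$, $N+1<\frac1{2\epsilon}$, put $$\lambda_k^\pm=\frac{-1\pm\sqrt{1-4\epsilon^2k^2}}{2\epsilon^2},\qquad e_k^\pm=(\sin kx,\lambda_k^\pm\sin kx)\quad(1\le k\le N),$$ $E_1=\mathrm{Span}\{e_k^+:1\le k\le N\}$, $E_{-1}=\mathrm{Span}\{e_k^-:1\le k\le N\}$, let $E_{22}$ be the closed span of the modes $(\sin kx,0),(0,\sin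 kx)$, $k\ge N+1$, and $E_2=E_{-1}\oplus E_{22}$. Equip $E$ with the equivalent norm $\|\cdot\|_E$ of the inner product that makes $E_{11}=E_1\oplus E_{-1}$ and $E_{22}$ orthogonal and is given, with $\tilde A=-\Delta$, by $$\tfrac1{4\epsilon^2}\langle u_1,u_2\rangle-\langle\tilde A^{1/2}u_1,\tilde A^{1/2}u_2\rangle+\langle\tfrac1{2\epsilon}u_1+\epsilon v_1,\tfrac1{2\epsilon}u_2+\epsilon v_2\rangle\ \text{ on }E_{11},$$ $$\langle\tilde A^{1/2}u_1,\tilde A^{1/2}u_2\rangle+\big(\tfrac1{4\epsilon^2}-2(N+1)^2\big)\langle u_1,u_2\rangle+\langle\tfrac1{2\epsilon}u_1+\epsilon v_1,\tfrac1{2\epsilon}u_2+\epsilon v_2\rangle\ \text{ on }E_{22}.$$ Let $\lambda_{N+1}^+<\eta<\lambda_N^+$ satisfy the spectral gap condition $$\frac{\mathrm{Lip}f}{\sqrt{\frac14-\epsilon^2(N+1)^2}}\left(\frac1{\lambda_N^+-\eta}+\frac1{\eta-\lambda_{N+1}^+}\right)<1$$ (it holds for $\eta=\frac12(\lambda_N^++\lambda_{N+1}^+)$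 when $N$ is large and then $\epsilon$ is small). For $\delta>0$ let $M_\delta(\omega)$ be the manifold of (W) constructed by the Lyapunov–Perron method, that is, the set of all $U(0)$, where $U$ is a solution of (W) on $(-\infty,0]$ driven by $\omega$ with $\sup_{t\le 0}e^{-\eta t}\|U(t)\|_E<\infty$, and let $M_0$ be the same set for $\delta=0$, which does not depend on $\omega$. Assume that, for the paths in a $\theta$-invariant set of full measure that does not depend on $\delta$, $M_\delta(\omega)$ is a stochastic inertial manifold of (W), and $M_0$ an inertial manifold for $\delta=0$, both of dimension $N$: they are random sets, invariant, graphs $\{\xi+h_\delta(\xi,\omega):\xi\in E_1\}$ and $\{\xi+h_0(\xi):\xi\in E_1\}$ of Lipschitz maps $E_1\to E_2$, and attract every orbit exponentially. For $R>0$ put $M_\delta^R(\omega)=\{\xi+h_\delta(\xi,\omega):\xi\in E_1,\ \|\xi\|_E\le R\}$. Then, almost surely, for every $R>0$, $$\lim_{\delta\to0^+}\ \sup_{U\in M_\delta^R(\omega)}\ \inf_{V\in M_0}\|U-V\|_E=0 .$$ Moreover, almost surely there is a finite $c_3(\omega)$, independent of $\delta$ and $R$, such that for all $\delta>0$ and $R>0$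 $$\sup_{U\in M_\delta^R(\omega)}\ \inf_{V\in M_0}\|U-V\|_E\le\delta\,c_3(\omega).$$ -/

import Mathlib

open MeasureTheory Set Filter Topology

namespace DampedWave

noncomputable section

/-! ### Function spaces on the interval `(0, π)` -/

/-- The real Hilbert space `L²(0, π)`. -/
abbrev L2 : Type := Lp ℝ 2 (volume.restrict (Ioo (0 : ℝ) Real.pi))

theorem memLp_of_continuous {ψ : ℝ → ℝ} (hψ : Continuous ψ) :
    MemLp ψ 2 (volume.restrict (Ioo (0 : ℝ) Real.pi)) := by
  obtain ⟨C, hC⟩ := (isCompact_Icc (a := (0 : ℝ)) (b := Real.pi)).exists_bound_of_continuousOn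
    hψ.continuousOn
  refine MemLp.of_bound hψ.aestronglyMeasurable C ?_
  filter_upwards [ae_restrict_mem measurableSet_Ioo] with x hx
  exact hC x (Ioo_subset_Icc_self hx)

/-- The class in `L²(0, π)` of a continuous function. -/
def toL2 (ψ : ℝ → ℝ) (hψ : Continuous ψ) : L2 := (memLp_of_continuous hψ).toLp ψ

theorem inner_toL2 (a b : ℝ → ℝ) (ha : Continuous a) (hb : Continuous b) :
    inner ℝ (toL2 a ha) (toL2 b hb) = ∫ x in (0 : ℝ)..Real.pi, a x * b x := by
  rw [L2.inner_def, intervalIntegral.integral_of_le Real.pi_pos.le,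
    integral_Ioc_eq_integral_Ioo]
  refine integral_congr_ae ?_
  filter_upwards [(memLp_of_continuous ha).coeFn_toLp, (memLp_of_continuous hb).coeFn_toLp]
    with x hx hy
  simp only [toL2, hx, hy]
  simp [mul_comm]

/-- The Sobolev space `H₀¹(0, π)`, as the space of pairs `(u, u_x)`. The identity
`∫ u ψ' = - ∫ u_x ψ` over `(0, π)` is required for all smooth `ψ` on the line, without any
condition at `0` and `π`; so `u_x` is the weak derivative of `u`, and the boundary values of `u`
vanish (equivalently, the extension of `u` by zero has the extension of `u_x` by zero as its weak
derivative on `ℝ`). -/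
def H10 : Submodule ℝ (L2 × L2) where
  carrier := {p | ∀ (ψ : ℝ → ℝ) (hψ : ContDiff ℝ ((⊤ : ℕ∞) : WithTop ℕ∞) ψ),
    inner ℝ p.1 (toL2 (deriv ψ) (hψ.continuous_deriv (by norm_cast))) =
      -inner ℝ p.2 (toL2 ψ hψ.continuous)}
  add_mem' := by
    intro p q hp hq ψ hψ
    have h1 := hp ψ hψ
    have h2 := hq ψ hψ
    simp only [Prod.fst_add, Prod.snd_add, inner_add_left, h1, h2]
    ring
  zero_mem' := by
    intro ψ hψ
    simp
  smul_mem' := by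
    intro c p hp ψ hψ
    have h1 := hp ψ hψ
    simp only [Prod.smul_fst, Prod.smul_snd, inner_smul_left, h1]
    ring

/-- The energy space `H₀¹(0, π) × L²(0, π)`, with its usual topology. -/
abbrev E : Type := H10 × L2

/-- The first component of a state, in `L²`. -/
abbrev pos (U : E) : L2 := U.1.1.1

/-- The spatial derivative of the first component of a state. -/
abbrev posx (U : E) : L2 := U.1.1.2

/-- The second component (the velocity) of a state. -/
abbrev vel (U : E) : L2 := U.2

/-! ### Eigenfunctions, the splitting of the energy space, and the adapted norm -/

/-- `sin (k x)` in `L²(0, π)`. -/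
def sinL2 (k : ℕ) : L2 := toL2 (fun x => Real.sin (k * x)) (by fun_prop)

theorem sin_mem_H10 (k : ℕ) :
    ((sinL2 k, toL2 (fun x => k * Real.cos (k * x)) (by fun_prop)) : L2 × L2) ∈ H10 := by
  intro ψ hψ
  have hd : Continuous (deriv ψ) := hψ.continuous_deriv (by norm_cast)
  have hdiff : Differentiable ℝ ψ := hψ.differentiable (by simp)
  simp only [sinL2]
  rw [inner_toL2, inner_toL2]
  have h := intervalIntegral.integral_mul_deriv_eq_deriv_mul (a := (0 : ℝ)) (b := Real.pi)
    (u := fun x : ℝ => Real.sin (k * x)) (v := ψ)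
    (u' := fun x : ℝ => k * Real.cos (k * x)) (v' := deriv ψ)
    (fun x _ => by
      have h0 := ((hasDerivAt_id x).const_mul (k : ℝ)).sin
      simpa [mul_comm] using h0)
    (fun x _ => (hdiff x).hasDerivAt)
    (Continuous.intervalIntegrable (by fun_prop) _ _) (hd.intervalIntegrable _ _)
  rw [h]
  simp [Real.sin_nat_mul_pi]

/-- `sin (k x)` in `H₀¹(0, π)`. -/
def sinH10 (k : ℕ) : H10 := ⟨_, sin_mem_H10 k⟩

/-- The sine coefficient `(2 / π) ∫ g(x) sin (k x) dx`. -/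
def sinCoeff (k : ℕ) (g : L2) : ℝ := 2 / Real.pi * inner ℝ (sinL2 k) g

/-- `λ_k⁺ = (-1 + √(1 - 4 ε² k²)) / (2 ε²)`. -/
def lamPlus (ε : ℝ) (k : ℕ) : ℝ := (-1 + √(1 - 4 * ε ^ 2 * (k : ℝ) ^ 2)) / (2 * ε ^ 2)

/-- `λ_k⁻ = (-1 - √(1 - 4 ε² k²)) / (2 ε²)`. -/
def lamMinus (ε : ℝ) (k : ℕ) : ℝ := (-1 - √(1 - 4 * ε ^ 2 * (k : ℝ) ^ 2)) / (2 * ε ^ 2)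

/-- `e_k⁺ = (sin kx, λ_k⁺ sin kx)`. -/
def ePlus (ε : ℝ) (k : ℕ) : E := (sinH10 k, lamPlus ε k • sinL2 k)

/-- `e_k⁻ = (sin kx, λ_k⁻ sin kx)`. -/
def eMinus (ε : ℝ) (k : ℕ) : E := (sinH10 k, lamMinus ε k • sinL2 k)

/-- `E₁`, the span of `e_k⁺`, `1 ≤ k ≤ N`. -/
def E1 (ε : ℝ) (N : ℕ) : Submodule ℝ E := Submodule.span ℝ (ePlus ε '' Set.Icc 1 N)

/-- `E₋₁`, the span of `e_k⁻`, `1 ≤ k ≤ N`. -/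
def Em1 (ε : ℝ) (N : ℕ) : Submodule ℝ E := Submodule.span ℝ (eMinus ε '' Set.Icc 1 N)

/-- `E₂₂`, the closed span of the modes `k ≥ N + 1`: the states both components of which have
vanishing sine coefficients for `1 ≤ k ≤ N`. -/
def E22 (N : ℕ) : Submodule ℝ E where
  carrier := {U | ∀ k ∈ Set.Icc 1 N, sinCoeff k (pos U) = 0 ∧ sinCoeff k (vel U) = 0}
  add_mem' := by
    intro U V hU hV k hk
    obtain ⟨h1, h2⟩ := hU k hk
    obtain ⟨h3, h4⟩ := hV k hk
    simp only [sinCoeff, pos, vel] at h1 h2 h3 h4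
    simp only [sinCoeff, pos, vel, Prod.fst_add, Prod.snd_add, Submodule.coe_add, inner_add_right,
      mul_add, h1, h2, h3, h4, add_zero, and_self]
  zero_mem' := by
    intro k _
    simp [sinCoeff, pos, vel]
  smul_mem' := by
    intro c U hU k hk
    obtain ⟨h1, h2⟩ := hU k hk
    simp only [sinCoeff, pos, vel] at h1 h2
    simp only [sinCoeff, pos, vel, Prod.smul_fst, Prod.smul_snd, Submodule.coe_smul,
      inner_smul_right, mul_left_comm _ c, h1, h2, mul_zero, and_self]

/-- `E₂ = E₋₁ ⊕ E₂₂`. -/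
def E2 (ε : ℝ) (N : ℕ) : Submodule ℝ E := Em1 ε N ⊔ E22 N

/-- The component of a state in `E₁₁ = E₁ ⊕ E₋₁`, that is, its modes `1 ≤ k ≤ N`. -/
def lowPart (N : ℕ) (U : E) : E :=
  ∑ k ∈ Finset.Icc 1 N, (sinCoeff k (pos U) • sinH10 k, sinCoeff k (vel U) • sinL2 k)

/-- The component of a state in `E₂₂`. -/
def highPart (N : ℕ) (U : E) : E := U - lowPart N U

/-- The inner product `⟨·, ·⟩_{E₁₁}`. -/
def innerE11 (ε : ℝ) (U V : E) : ℝ :=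
  1 / (4 * ε ^ 2) * inner ℝ (pos U) (pos V) - inner ℝ (posx U) (posx V)
    + inner ℝ ((1 / (2 * ε)) • pos U + ε • vel U) ((1 / (2 * ε)) • pos V + ε • vel V)

/-- The inner product `⟨·, ·⟩_{E₂₂}`. -/
def innerE22 (ε : ℝ) (N : ℕ) (U V : E) : ℝ :=
  inner ℝ (posx U) (posx V) + (1 / (4 * ε ^ 2) - 2 * ((N : ℝ) + 1) ^ 2) * inner ℝ (pos U) (pos V)
    + inner ℝ ((1 / (2 * ε)) • pos U + ε • vel U) ((1 / (2 * ε)) • pos V + ε • vel V)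

/-- The adapted inner product `⟨·, ·⟩_E` of the energy space. -/
def innerE (ε : ℝ) (N : ℕ) (U V : E) : ℝ :=
  innerE11 ε (lowPart N U) (lowPart N V) + innerE22 ε N (highPart N U) (highPart N V)

/-- The adapted norm `‖·‖_E`. -/
def normE (ε : ℝ) (N : ℕ) (U : E) : ℝ := √(innerE ε N U U)

/-- The distance `inf_{V ∈ M} ‖U - V‖_E` from a point to a set (infinite if the set is empty). -/
def distE (ε : ℝ) (N : ℕ) (U : E) (M : Set E) : ENNReal :=
  ⨅ V ∈ M, ENNReal.ofReal (normE ε N (U - V))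

/-- The Hausdorff semi-distance `sup_{U ∈ M₁} inf_{V ∈ M₂} ‖U - V‖_E`. -/
def semiDist (ε : ℝ) (N : ℕ) (M₁ M₂ : Set E) : ENNReal := ⨆ U ∈ M₁, distE ε N U M₂

/-! ### The noise -/

/-- The canonical path space `C₀(ℝ, ℝ)`: continuous paths that vanish at time zero. -/
def Path : Type := {ω : C(ℝ, ℝ) // ω 0 = 0}

instance : CoeFun Path (fun _ => ℝ → ℝ) := ⟨fun ω t => ω.1 t⟩

/-- The σ-algebra generated by the coordinates (the Borel σ-algebra of locally uniform
convergence). -/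
instance : MeasurableSpace Path :=
  MeasurableSpace.comap (fun (ω : Path) (t : ℝ) => ω t) MeasurableSpace.pi

/-- The Wiener shift `(θ_t ω)(s) = ω(t + s) - ω(t)`. -/
def shift (t : ℝ) (ω : Path) : Path :=
  ⟨⟨fun s => ω (t + s) - ω t, by
    have h : Continuous ω.1 := ω.1.continuous
    fun_prop⟩, by simp⟩

/-- `ℙ` is the two-sided Wiener measure: under `ℙ` the coordinate process has independent
increments, and `ω(t) - ω(s)` is centred Gaussian with variance `t - s` for `s ≤ t`. -/
structure IsWienerMeasure (ℙ : Measure Path) : Prop where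
  isProbabilityMeasure : IsProbabilityMeasure ℙ
  indep : ProbabilityTheory.HasIndepIncrements (fun (t : ℝ) (ω : Path) => ω t) ℙ
  gaussian : ∀ s t : ℝ, s ≤ t →
    ℙ.map (fun ω : Path => ω t - ω s) = ProbabilityTheory.gaussianReal 0 (Real.toNNReal (t - s))

/-! ### The damped wave equation -/

/-- `U = (u, v)` solves, on the time interval `I`,
`ε² du_t + (u_t - u_xx) dt = f(u) dt + δ φ dw`, `u_t = v`, `u(t, 0) = u(t, π) = 0`,
for the driving path `w`: it is a continuous curve in the energy space, `u` is an integral of `v`,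
and the equation for the velocity holds, integrated in time, when tested with every element of
`H₀¹(0, π)`. -/
structure IsSolution (ε δ : ℝ) (f : L2 → L2) (φ : H10) (w : ℝ → ℝ) (I : Set ℝ) (U : ℝ → E) :
    Prop where
  continuousOn : ContinuousOn U I
  position : ∀ s ∈ I, ∀ t ∈ I, pos (U t) - pos (U s) = ∫ r in s..t, vel (U r)
  velocity : ∀ s ∈ I, ∀ t ∈ I, ∀ ψ : H10,
    ε ^ 2 * inner ℝ (vel (U t) - vel (U s)) ψ.1.1
        + ∫ r in s..t, (inner ℝ (vel (U r)) ψ.1.1 + inner ℝ (posx (U r)) ψ.1.2)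
      = (∫ r in s..t, inner ℝ (f (pos (U r))) ψ.1.1) + δ * (w t - w s) * inner ℝ φ.1.1 ψ.1.1

/-! ### Inertial manifolds -/

/-- The graph `{ξ + h(ξ) | ξ ∈ E₁}`. -/
def graphE {ε : ℝ} {N : ℕ} (h : E1 ε N → E2 ε N) : Set E :=
  {U | ∃ ξ : E1 ε N, U = (ξ : E) + (h ξ : E)}

/-- The piece `{ξ + h(ξ) | ξ ∈ E₁, ‖ξ‖_E ≤ R}` of a graph. -/
def truncGraphE {ε : ℝ} {N : ℕ} (R : ℝ) (h : E1 ε N → E2 ε N) : Set E :=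
  {U | ∃ ξ : E1 ε N, normE ε N (ξ : E) ≤ R ∧ U = (ξ : E) + (h ξ : E)}

/-- `M` is a stochastic inertial manifold of the damped wave equation, for the paths in the set
`S`: a random set which is the graph of a Lipschitz map `h` from the finite-dimensional space `E₁`
to `E₂`, is invariant, and attracts all orbits exponentially. A set `M` that does not depend
on `ω`, with `δ = 0`, is a (deterministic) inertial manifold. -/
structure IsInertialManifold (ε δ : ℝ) (f : L2 → L2) (φ : H10) (N : ℕ) (S : Set Path)
    (M : Path → Set E) (h : Path → E1 ε N → E2 ε N) : Prop where
  measurable : ∀ U : E, Measurable (fun ω : S => distE ε N U (M ω))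
  graph : ∀ ω ∈ S, M ω = graphE (h ω)
  lipschitz : ∀ ω ∈ S, ∃ L : ℝ, ∀ ξ₁ ξ₂ : E1 ε N,
    normE ε N ((h ω ξ₁ : E) - (h ω ξ₂ : E)) ≤ L * normE ε N ((ξ₁ : E) - (ξ₂ : E))
  invariant : ∀ ω ∈ S, ∀ U : ℝ → E, IsSolution ε δ f φ ω (Set.Ici 0) U → U 0 ∈ M ω →
    ∀ t : ℝ, 0 ≤ t → U t ∈ M (shift t ω)
  attracts : ∃ c : ℝ, 0 < c ∧ ∀ ω ∈ S, ∀ U : ℝ → E, IsSolution ε δ f φ ω (Set.Ici 0) U →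
    ∃ C : ℝ, ∀ t : ℝ, 0 ≤ t →
      distE ε N (U t) (M (shift t ω)) ≤ ENNReal.ofReal (C * Real.exp (-c * t))

/-- The manifold `M_δ` constructed by the Lyapunov–Perron method: all initial values `U(0)` of solutions on `(-∞, 0]` which belong
to `C_η⁻`, that is, for which `e^{-ηt} ‖U(t)‖_E` is bounded over `t ≤ 0`. -/
def lpManifold (ε δ : ℝ) (f : L2 → L2) (φ : H10) (N : ℕ) (η : ℝ) (w : ℝ → ℝ) : Set E :=
  {U₀ | ∃ U : ℝ → E, IsSolution ε δ f φ w (Set.Iic 0) U ∧ U 0 = U₀ ∧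
    ∃ C : ℝ, ∀ t : ℝ, t ≤ 0 → Real.exp (-η * t) * normE ε N (U t) ≤ C}

end

end DampedWave

namespace DampedWave

noncomputable section

/-! ### Sine and cosine expansions in `L²(0, π)` -/

/-! The noise is additive and enters with the factor `δ`, so one pair of solutions removes it for
every `δ`. Fix a path. Let `U₁`, `V₁` be the backward solutions through the points over `ξ = 0` of
the manifolds for `δ = 1` and for `δ = 0`, and let `Z = U₁ - V₁`. For arbitrary `δ` and `ξ`, let
`U`, `V` be the backward solutions through the points over the same `ξ` of the manifolds for `δ` and
for `0`. In `D = U - V - δ Z` the noise cancels exactly. What remains is a deterministic damped wave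
equation with forcing `f(U) - f(V) - δ (f(U₁) - f(V₁))`, whose norm is at most `Lip f · (‖D‖ + 2 δ
‖Z‖)` in terms of the first components. Moreover `D` is `O(e^{ηt})` as `t → -∞`, and `D 0` lies in
`E₂`, since points over the same `ξ` differ by an element of `E₂`.

For such `D` the linear estimate `normE_le_of_hasModeDeriv` bounds the weighted supremum of `D` by
that of the forcing. In sine coefficients the equation splits into planar systems. The energy of the
`E₁` part vanishes at time `0` and is controlled backwards from there; the energy of the `E₂` part
is controlled from `-∞` by the growth condition. Together with the Lipschitz bound and
`norm_pos_le`, the factor is the left side of the gap condition, so it is less than `1` and the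
weighted supremum of `D` is `O(δ)`. The constant depends only on `Z`, hence on the path but not on
`δ`, `ξ` or `R`; this is `exists_normE_sub_le`.

The Fourier part supplies Parseval identities: for `u` and `v` in sines, for `u_x` in cosines. -/

theorem toL2_eq_of_forall {a b c : ℝ → ℝ} (ha : Continuous a) (hb : Continuous b)
    (hc : Continuous c) (p q : ℝ) (h : ∀ x, a x = p * b x + q * c x) :
    toL2 a ha = p • toL2 b hb + q • toL2 c hc := by
  have : a = p • b + q • c := by
    ext x
    simp [h]
  subst this
  rfl

theorem norm_toL2_le {a : ℝ → ℝ} (ha : Continuous a) {C : ℝ} (hC : 0 ≤ C)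
    (h : ∀ x ∈ Ioo 0 Real.pi, |a x| ≤ C) :
    ‖toL2 a ha‖ ≤ (measureUnivNNReal (volume.restrict (Ioo (0 : ℝ) Real.pi)) : ℝ) ^
      (2 : ENNReal).toReal⁻¹ * C := by
  refine Lp.norm_le_of_ae_bound hC ?_
  filter_upwards [(memLp_of_continuous ha).coeFn_toLp, ae_restrict_mem measurableSet_Ioo]
    with x hx hm
  rw [toL2, hx]
  exact h x hm

theorem inner_toL2_left (a : ℝ → ℝ) (ha : Continuous a) (g : L2) :
    inner ℝ (toL2 a ha) g = ∫ x in Ioo (0 : ℝ) Real.pi, a x * g x := by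
  rw [L2.inner_def]
  refine integral_congr_ae ?_
  filter_upwards [(memLp_of_continuous ha).coeFn_toLp] with x hx
  simp only [toL2, hx]
  simp [mul_comm]

/-- The product formula trades one factor `cos x` for the frequencies `k ± 1`, so the induction on
the power must carry all frequencies at once. -/
theorem inner_cos_pow_mul_cos_eq_zero {g : L2}
    (hg : ∀ k : ℕ, inner ℝ (toL2 (fun x => Real.cos (k * x)) (by fun_prop)) g = 0) (n k : ℕ) :
    inner ℝ (toL2 (fun x => Real.cos x ^ n * Real.cos (k * x)) (by fun_prop)) g = 0 := by
  induction n generalizing k with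
  | zero => simpa using hg k
  | succ n ih =>
    cases k with
    | zero => simpa [pow_succ] using ih 1
    | succ k =>
      rw [toL2_eq_of_forall (b := fun x => Real.cos x ^ n * Real.cos ((k + 2 : ℕ) * x))
        (c := fun x => Real.cos x ^ n * Real.cos (k * x)) _ (by fun_prop) (by fun_prop)
        (1 / 2) (1 / 2)]
      · simp only [inner_add_left, inner_smul_left, ih, mul_zero, add_zero]
      · intro x
        have h1 : ((k + 2 : ℕ) : ℝ) * x = (k + 1 : ℕ) * x + x := by push_cast; ring
        have h2 : (k : ℝ) * x = (k + 1 : ℕ) * x - x := by push_cast; ring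
        rw [h1, h2, Real.cos_add, Real.cos_sub]
        ring

theorem inner_polynomial_cos_eq_zero {g : L2}
    (hg : ∀ k : ℕ, inner ℝ (toL2 (fun x => Real.cos (k * x)) (by fun_prop)) g = 0)
    (p : Polynomial ℝ) :
    inner ℝ (toL2 (fun x => p.eval (Real.cos x)) (by fun_prop)) g = 0 := by
  induction p using Polynomial.induction_on' with
  | add p q hp hq =>
    rw [toL2_eq_of_forall (b := fun x => p.eval (Real.cos x)) (c := fun x => q.eval (Real.cos x))
      _ (by fun_prop) (by fun_prop) 1 1 (by simp)]
    simp [inner_add_left, hp, hq]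
  | monomial n a =>
    rw [toL2_eq_of_forall (b := fun x => Real.cos x ^ n * Real.cos ((0 : ℕ) * x))
      (c := fun x => Real.cos x ^ n * Real.cos ((0 : ℕ) * x)) _ (by fun_prop) (by fun_prop) a 0
      (by simp)]
    simp only [inner_add_left, inner_smul_left, inner_cos_pow_mul_cos_eq_zero hg, mul_zero,
      add_zero]

/-- Since `cos` is injective on `[0, π]`, a continuous `ψ` is a continuous function of `cos x`
there. By Weierstrass it is a uniform limit of polynomials in `cos x`, and continuous functions are
dense in `L²`. -/
theorem eq_zero_of_inner_cos {g : L2}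
    (hg : ∀ k : ℕ, inner ℝ (toL2 (fun x => Real.cos (k * x)) (by fun_prop)) g = 0) : g = 0 := by
  have hcont : ∀ (ψ : ℝ → ℝ) (hψ : Continuous ψ), inner ℝ (toL2 ψ hψ) g = 0 := by
    intro ψ hψ
    set A := (measureUnivNNReal (volume.restrict (Ioo (0 : ℝ) Real.pi)) : ℝ) ^
      (2 : ENNReal).toReal⁻¹ with hA
    have hA0 : 0 ≤ A := by positivity
    by_contra hne
    have hpos : 0 < |inner ℝ (toL2 ψ hψ) g| := abs_pos.2 hne
    -- The summand `1` makes `A * ε * ‖g‖` strictly smaller than the inner product, which gives the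
    -- contradiction.
    set ε := |inner ℝ (toL2 ψ hψ) g| / (A * ‖g‖ + 1) with hε
    have hε0 : 0 < ε := by positivity
    obtain ⟨p, hp⟩ := exists_polynomial_near_of_continuousOn (-1) 1 (fun y => ψ (Real.arccos y))
      (hψ.comp Real.continuous_arccos).continuousOn ε hε0
    have hsub : toL2 (fun x => ψ x - p.eval (Real.cos x)) (by fun_prop)
        = toL2 ψ hψ - toL2 (fun x => p.eval (Real.cos x)) (by fun_prop) := by
      rw [toL2_eq_of_forall _ hψ (c := fun x => p.eval (Real.cos x)) (by fun_prop) 1 (-1)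
        (fun x => by ring)]
      simp [sub_eq_add_neg]
    have hn : ‖toL2 (fun x => ψ x - p.eval (Real.cos x)) (by fun_prop)‖ ≤ A * ε := by
      refine norm_toL2_le _ hε0.le fun x hx => ?_
      have := hp (Real.cos x) ⟨Real.neg_one_le_cos x, Real.cos_le_one x⟩
      rw [Real.arccos_cos hx.1.le hx.2.le] at this
      rw [abs_sub_comm]
      exact this.le
    have h1 : inner ℝ (toL2 ψ hψ) g
        = inner ℝ (toL2 (fun x => ψ x - p.eval (Real.cos x)) (by fun_prop)) g := by
      rw [hsub, inner_sub_left, inner_polynomial_cos_eq_zero hg, sub_zero]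
    have h2 : |inner ℝ (toL2 ψ hψ) g| ≤ A * ε * ‖g‖ := by
      rw [h1]
      exact (abs_real_inner_le_norm _ _).trans (by gcongr)
    have h3 : |inner ℝ (toL2 ψ hψ) g| = ε * (A * ‖g‖ + 1) := by
      rw [hε]; field_simp
    nlinarith
  refine (BoundedContinuousFunction.toLp_denseRange (p := 2) ℝ
    (volume.restrict (Ioo (0 : ℝ) Real.pi)) ℝ (by norm_num)).eq_zero_of_inner_right ℝ ?_
  intro ψ
  exact hcont ψ ψ.continuous

/-- Reduction to the cosines: `cos (kx) sin x` is a combination of sines, so `sin x · g` is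
orthogonal to every cosine. Hence it vanishes, and `sin x > 0` on `(0, π)`. -/
theorem eq_zero_of_inner_sin {g : L2} (hg : ∀ k : ℕ, inner ℝ (sinL2 k) g = 0) : g = 0 := by
  have hmem : MemLp (fun x => Real.sin x * g x) 2 (volume.restrict (Ioo (0 : ℝ) Real.pi)) := by
    refine MemLp.of_le (Lp.memLp g)
      ((Real.continuous_sin.aestronglyMeasurable).mul (Lp.memLp g).1) (ae_of_all _ fun x => ?_)
    rw [norm_mul]
    exact mul_le_of_le_one_left (norm_nonneg _) (Real.abs_sin_le_one x)
  have hz : hmem.toLp _ = 0 := by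
    refine eq_zero_of_inner_cos fun k => ?_
    have h1 : inner ℝ (toL2 (fun x => Real.cos (k * x)) (by fun_prop)) (hmem.toLp _)
        = inner ℝ (toL2 (fun x => Real.cos (k * x) * Real.sin x) (by fun_prop)) g := by
      rw [inner_toL2_left, inner_toL2_left]
      refine integral_congr_ae ?_
      filter_upwards [hmem.coeFn_toLp] with x hx
      rw [hx]; ring
    rw [h1]
    cases k with
    | zero => simpa [sinL2] using hg 1
    | succ k =>
      rw [toL2_eq_of_forall (b := fun x => Real.sin ((k + 2 : ℕ) * x))
        (c := fun x => Real.sin (k * x)) _ (by fun_prop) (by fun_prop) (1 / 2) (-1 / 2)]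
      · have h2 := hg (k + 2)
        have h3 := hg k
        simp only [sinL2] at h2 h3
        simp only [inner_add_left, inner_smul_left, h2, h3, mul_zero, add_zero]
      · intro x
        have h1 : ((k + 2 : ℕ) : ℝ) * x = (k + 1 : ℕ) * x + x := by push_cast; ring
        have h2 : (k : ℝ) * x = (k + 1 : ℕ) * x - x := by push_cast; ring
        rw [h1, h2, Real.sin_add, Real.sin_sub]
        ring
  refine Lp.ext ?_
  have h0 : hmem.toLp _ =ᵐ[volume.restrict (Ioo (0 : ℝ) Real.pi)] (0 : ℝ → ℝ) := by
    rw [hz]; exact Lp.coeFn_zero _ _ _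
  filter_upwards [h0, hmem.coeFn_toLp, ae_restrict_mem measurableSet_Ioo,
    Lp.coeFn_zero ℝ 2 (volume.restrict (Ioo (0 : ℝ) Real.pi))] with x h1 h2 hx h3
  rw [h3]
  rw [h2] at h1
  have := Real.sin_pos_of_pos_of_lt_pi hx.1 hx.2
  simpa [this.ne'] using h1

theorem integral_cos_int_mul (m : ℤ) :
    ∫ x in (0 : ℝ)..Real.pi, Real.cos (m * x) = if m = 0 then Real.pi else 0 := by
  split_ifs with h
  · simp [h]
  · have hm : (m : ℝ) ≠ 0 := by exact_mod_cast h
    rw [intervalIntegral.integral_comp_mul_left (fun x => Real.cos x) hm, integral_cos]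
    simp [Real.sin_int_mul_pi]

theorem integral_cos_mul_cos (j k : ℕ) :
    ∫ x in (0 : ℝ)..Real.pi, Real.cos (j * x) * Real.cos (k * x) =
      ((if j = k then Real.pi else 0) + if j + k = 0 then Real.pi else 0) / 2 := by
  have h : ∀ x : ℝ, Real.cos (j * x) * Real.cos (k * x)
      = (1 / 2) * (Real.cos (((j - k : ℤ) : ℝ) * x) + Real.cos (((j + k : ℤ) : ℝ) * x)) := by
    intro x
    push_cast
    rw [sub_mul, add_mul, Real.cos_sub, Real.cos_add]
    ring
  simp_rw [h]
  rw [intervalIntegral.integral_const_mul, intervalIntegral.integral_add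
    (Continuous.intervalIntegrable (by fun_prop) _ _)
    (Continuous.intervalIntegrable (by fun_prop) _ _), integral_cos_int_mul, integral_cos_int_mul]
  have e1 : ((j : ℤ) - k = 0) ↔ j = k := by omega
  have e2 : ((j : ℤ) + k = 0) ↔ j + k = 0 := by omega
  simp only [e1, e2]
  ring

theorem integral_sin_mul_sin (j k : ℕ) :
    ∫ x in (0 : ℝ)..Real.pi, Real.sin (j * x) * Real.sin (k * x) =
      ((if j = k then Real.pi else 0) - if j + k = 0 then Real.pi else 0) / 2 := by
  have h : ∀ x : ℝ, Real.sin (j * x) * Real.sin (k * x)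
      = (1 / 2) * (Real.cos (((j - k : ℤ) : ℝ) * x) - Real.cos (((j + k : ℤ) : ℝ) * x)) := by
    intro x
    push_cast
    rw [sub_mul, add_mul, Real.cos_sub, Real.cos_add]
    ring
  simp_rw [h]
  rw [intervalIntegral.integral_const_mul, intervalIntegral.integral_sub
    (Continuous.intervalIntegrable (by fun_prop) _ _)
    (Continuous.intervalIntegrable (by fun_prop) _ _), integral_cos_int_mul, integral_cos_int_mul]
  have e1 : ((j : ℤ) - k = 0) ↔ j = k := by omega
  have e2 : ((j : ℤ) + k = 0) ↔ j + k = 0 := by omega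
  simp only [e1, e2]
  ring

theorem sinCoeff_sinL2 (j : ℕ) {k : ℕ} (hk : 1 ≤ k) :
    sinCoeff j (sinL2 k) = if j = k then 1 else 0 := by
  rw [sinCoeff, sinL2, sinL2, inner_toL2, integral_sin_mul_sin,
    if_neg (show ¬ j + k = 0 by omega)]
  have := Real.pi_pos.ne'
  split_ifs
  · field_simp; simp
  · simp

theorem sinCoeff_zero_left (g : L2) : sinCoeff 0 g = 0 := by
  have : sinL2 0 = 0 := by
    rw [sinL2, toL2_eq_of_forall (b := fun _ => 0) (c := fun _ => 0) _ continuous_const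
      continuous_const 0 0 (by simp)]
    simp
  simp [sinCoeff, this]

/-- The Parseval identity for sine series. -/
theorem hasSum_sinCoeff_sq (g : L2) :
    HasSum (fun k => Real.pi / 2 * sinCoeff k g ^ 2) (‖g‖ ^ 2) := by
  have hπ := Real.pi_pos
  have hs : √(2 / Real.pi) ^ 2 = 2 / Real.pi := Real.sq_sqrt (by positivity)
  have hon : Orthonormal ℝ (fun k : ℕ => √(2 / Real.pi) • sinL2 (k + 1)) := by
    rw [orthonormal_iff_ite]
    intro i j
    rw [inner_smul_left, inner_smul_right, sinL2, sinL2, inner_toL2, integral_sin_mul_sin,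
      if_neg (show ¬ i + 1 + (j + 1) = 0 by omega), ← mul_assoc]
    simp only [conj_trivial, ← pow_two, hs, add_left_inj]
    split_ifs
    · field_simp; ring
    · simp
  have hsp : (Submodule.span ℝ (range fun k : ℕ => √(2 / Real.pi) • sinL2 (k + 1)))ᗮ = ⊥ := by
    rw [Submodule.eq_bot_iff]
    intro x hx
    refine eq_zero_of_inner_sin fun k => ?_
    cases k with
    | zero =>
      have := sinCoeff_zero_left x
      simpa [sinCoeff, hπ.ne'] using this
    | succ k =>
      have := (Submodule.mem_orthogonal _ _).1 hx _ (Submodule.subset_span ⟨k, rfl⟩)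
      rw [inner_smul_left] at this
      exact (mul_eq_zero.1 this).resolve_left
        (by simpa using (Real.sqrt_pos.2 (div_pos two_pos hπ)).ne')
  have h := (HilbertBasis.mkOfOrthogonalEqBot hon hsp).hasSum_inner_mul_inner g g
  rw [real_inner_self_eq_norm_sq] at h
  -- The basis is indexed from frequency `1`; the term of index `0` in the stated series is zero.
  rw [← hasSum_nat_add_iff' 1]
  simp only [Finset.range_one, Finset.sum_singleton, sinCoeff_zero_left]
  rw [zero_pow two_ne_zero, mul_zero, sub_zero]
  refine h.congr_fun fun k => ?_
  rw [HilbertBasis.coe_mkOfOrthogonalEqBot, real_inner_comm _ g, ← pow_two, inner_smul_left,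
    conj_trivial, mul_pow, hs, sinCoeff]
  field_simp

/-- The test functions in `H10` carry no boundary condition, so `cos (kx)` is admissible, including
the constant `k = 0`. -/
theorem inner_posx_cos (p : H10) (k : ℕ) :
    inner ℝ p.1.2 (toL2 (fun x => Real.cos (k * x)) (by fun_prop)) =
      k * inner ℝ (sinL2 k) p.1.1 := by
  have h := p.2 (fun x => Real.cos (k * x)) (by fun_prop)
  have hd : deriv (fun x : ℝ => Real.cos (k * x)) = fun x => -k * Real.sin (k * x) := by
    ext x
    have := (((hasDerivAt_id x).const_mul (k : ℝ)).cos).deriv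
    simp only [id, mul_one] at this
    rw [this]; ring
  simp only [hd] at h
  rw [toL2_eq_of_forall (b := fun x => Real.sin (k * x)) (c := fun x => Real.sin (k * x)) _
    (by fun_prop) (by fun_prop) (-k) 0 (by simp)] at h
  rw [← neg_eq_iff_eq_neg] at h
  rw [← h, real_inner_comm]
  simp [sinL2, inner_smul_left]

/-- The Parseval identity for the cosine series of the derivative of an element of `H₀¹`. -/
theorem hasSum_sq_mul_sinCoeff_sq (p : H10) :
    HasSum (fun k : ℕ => Real.pi / 2 * ((k : ℝ) ^ 2 * sinCoeff k p.1.1 ^ 2)) (‖p.1.2‖ ^ 2) := by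
  have hπ := Real.pi_pos
  have hs : √(2 / Real.pi) ^ 2 = 2 / Real.pi := Real.sq_sqrt (by positivity)
  have hs' : √(1 / Real.pi) ^ 2 = 1 / Real.pi := Real.sq_sqrt (by positivity)
  -- The squared norm of the constant is `π`, that of each other cosine is `π / 2`.
  set s : ℕ → ℝ := fun k => if k = 0 then √(1 / Real.pi) else √(2 / Real.pi) with hsdef
  have hs0 : ∀ k, s k ≠ 0 := by
    intro k
    simp only [hsdef]
    split_ifs
    · exact (Real.sqrt_pos.2 (div_pos one_pos hπ)).ne'
    · exact (Real.sqrt_pos.2 (div_pos two_pos hπ)).ne'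
  have hon : Orthonormal ℝ
      (fun k : ℕ => s k • toL2 (fun x => Real.cos (k * x)) (by fun_prop)) := by
    rw [orthonormal_iff_ite]
    intro i j
    rw [inner_smul_left, inner_smul_right, inner_toL2, integral_cos_mul_cos, ← mul_assoc]
    simp only [conj_trivial]
    by_cases hij : i = j
    · subst hij
      simp only [if_true, ← pow_two, hsdef]
      by_cases h0 : i = 0
      · simp only [h0, if_true, hs', add_zero]
        field_simp; ring
      · simp only [h0, if_false, hs, if_neg (show ¬ i + i = 0 by omega)]
        field_simp; ring
    · simp [hij]
      omega
  have hsp : (Submodule.span ℝ (range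
      fun k : ℕ => s k • toL2 (fun x => Real.cos (k * x)) (by fun_prop)))ᗮ = ⊥ := by
    rw [Submodule.eq_bot_iff]
    intro x hx
    refine eq_zero_of_inner_cos fun k => ?_
    have := (Submodule.mem_orthogonal _ _).1 hx _ (Submodule.subset_span ⟨k, rfl⟩)
    rw [inner_smul_left] at this
    simpa [hs0 k] using this
  have h := (HilbertBasis.mkOfOrthogonalEqBot hon hsp).hasSum_inner_mul_inner p.1.2 p.1.2
  rw [real_inner_self_eq_norm_sq] at h
  refine h.congr_fun fun k => ?_
  rw [HilbertBasis.coe_mkOfOrthogonalEqBot, real_inner_comm _ p.1.2, ← pow_two, inner_smul_left,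
    conj_trivial, real_inner_comm p.1.2, inner_posx_cos, mul_pow, mul_pow, sinCoeff]
  rcases Nat.eq_zero_or_pos k with h0 | h0
  · simp [h0]
  · simp only [hsdef, if_neg h0.ne', hs]
    field_simp

/-! ### The adapted norm in terms of sine coefficients -/

/-- The sine coefficient as a continuous linear form. -/
def sinCoeffL (k : ℕ) : L2 →L[ℝ] ℝ := (2 / Real.pi) • innerSL ℝ (sinL2 k)

theorem sinCoeffL_apply (k : ℕ) (g : L2) : sinCoeffL k g = sinCoeff k g := rfl

/-- The sine coefficient of the first component of a state. -/
def posCoeff (k : ℕ) : E →L[ℝ] ℝ :=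
  sinCoeffL k ∘L ContinuousLinearMap.fst ℝ L2 L2 ∘L H10.subtypeL ∘L
    ContinuousLinearMap.fst ℝ H10 L2

/-- The sine coefficient of the velocity of a state. -/
def velCoeff (k : ℕ) : E →L[ℝ] ℝ := sinCoeffL k ∘L ContinuousLinearMap.snd ℝ H10 L2

theorem posCoeff_apply (k : ℕ) (U : E) : posCoeff k U = sinCoeff k (pos U) := rfl

theorem velCoeff_apply (k : ℕ) (U : E) : velCoeff k U = sinCoeff k (vel U) := rfl

/-- The sine coefficient of `u / (2 ε) + ε v`. -/
def mixCoeff (ε : ℝ) (k : ℕ) : E →L[ℝ] ℝ := (1 / (2 * ε)) • posCoeff k + ε • velCoeff k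

theorem mixCoeff_apply (ε : ℝ) (k : ℕ) (U : E) :
    mixCoeff ε k U = 1 / (2 * ε) * posCoeff k U + ε * velCoeff k U := rfl

theorem posCoeff_zero_left (U : E) : posCoeff 0 U = 0 := sinCoeff_zero_left _

theorem velCoeff_zero_left (U : E) : velCoeff 0 U = 0 := sinCoeff_zero_left _

theorem mixCoeff_zero_left (ε : ℝ) (U : E) : mixCoeff ε 0 U = 0 := by
  simp [mixCoeff_apply, posCoeff_zero_left, velCoeff_zero_left]

theorem sinCoeff_mix (ε : ℝ) (k : ℕ) (U : E) :
    sinCoeff k ((1 / (2 * ε)) • pos U + ε • vel U) = mixCoeff ε k U := by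
  rw [mixCoeff_apply, posCoeff_apply, velCoeff_apply, ← sinCoeffL_apply, map_add, map_smul,
    map_smul]
  rfl

theorem posCoeff_lowPart (N k : ℕ) (U : E) :
    posCoeff k (lowPart N U) = if k ∈ Finset.Icc 1 N then posCoeff k U else 0 := by
  have h : ∀ j ∈ Finset.Icc 1 N, posCoeff k (sinCoeff j (pos U) • sinH10 j,
      sinCoeff j (vel U) • sinL2 j) = if k = j then posCoeff j U else 0 := by
    intro j hj
    have : posCoeff k (sinCoeff j (pos U) • sinH10 j, sinCoeff j (vel U) • sinL2 j)
      = sinCoeffL k (sinCoeff j (pos U) • sinL2 j) := rfl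
    rw [this, map_smul, sinCoeffL_apply, sinCoeff_sinL2 k (Finset.mem_Icc.1 hj).1]
    simp [posCoeff_apply]
  rw [lowPart, map_sum, Finset.sum_congr rfl h, Finset.sum_ite_eq]

theorem velCoeff_lowPart (N k : ℕ) (U : E) :
    velCoeff k (lowPart N U) = if k ∈ Finset.Icc 1 N then velCoeff k U else 0 := by
  have h : ∀ j ∈ Finset.Icc 1 N, velCoeff k (sinCoeff j (pos U) • sinH10 j,
      sinCoeff j (vel U) • sinL2 j) = if k = j then velCoeff j U else 0 := by
    intro j hj
    have : velCoeff k (sinCoeff j (pos U) • sinH10 j, sinCoeff j (vel U) • sinL2 j)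
      = sinCoeffL k (sinCoeff j (vel U) • sinL2 j) := rfl
    rw [this, map_smul, sinCoeffL_apply, sinCoeff_sinL2 k (Finset.mem_Icc.1 hj).1]
    simp [velCoeff_apply]
  rw [lowPart, map_sum, Finset.sum_congr rfl h, Finset.sum_ite_eq]

/-- The weight of the `k`-th sine coefficient of the first component in the adapted norm. -/
def modeWeight (ε : ℝ) (N k : ℕ) : ℝ :=
  if k ∈ Finset.Icc 1 N then 1 / (4 * ε ^ 2) - (k : ℝ) ^ 2
  else (k : ℝ) ^ 2 + (1 / (4 * ε ^ 2) - 2 * ((N : ℝ) + 1) ^ 2)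

/-- The contribution of the `k`-th mode to the square of the adapted norm. -/
def modeEnergy (ε : ℝ) (N k : ℕ) (U : E) : ℝ :=
  modeWeight ε N k * posCoeff k U ^ 2 + mixCoeff ε k U ^ 2

/-- Parseval applied to each term of the two quadratic forms. Each mode belongs to exactly one of
the low and high parts, so no cross terms arise. -/
theorem hasSum_modeEnergy (ε : ℝ) (N : ℕ) (U : E) :
    HasSum (fun k => Real.pi / 2 * modeEnergy ε N k U) (innerE ε N U U) := by
  set X := lowPart N U with hX
  set Y := highPart N U with hY
  have h1 := ((hasSum_sinCoeff_sq (pos X)).mul_left (1 / (4 * ε ^ 2))).sub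
    (hasSum_sq_mul_sinCoeff_sq X.1)
  have h2 := h1.add (hasSum_sinCoeff_sq ((1 / (2 * ε)) • pos X + ε • vel X))
  have h3 := (hasSum_sq_mul_sinCoeff_sq Y.1).add
    ((hasSum_sinCoeff_sq (pos Y)).mul_left (1 / (4 * ε ^ 2) - 2 * ((N : ℝ) + 1) ^ 2))
  have h4 := h3.add (hasSum_sinCoeff_sq ((1 / (2 * ε)) • pos Y + ε • vel Y))
  have h5 := h2.add h4
  rw [innerE, innerE11, innerE22, ← hX, ← hY]
  simp only [real_inner_self_eq_norm_sq]
  refine h5.congr_fun fun k => ?_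
  have ep : posCoeff k Y = posCoeff k U - posCoeff k X := by rw [hY, highPart, map_sub]
  have ev : velCoeff k Y = velCoeff k U - velCoeff k X := by rw [hY, highPart, map_sub]
  have ex := posCoeff_lowPart N k U
  have ex' := velCoeff_lowPart N k U
  rw [← hX] at ex ex'
  change _ = 1 / (4 * ε ^ 2) * (Real.pi / 2 * posCoeff k X ^ 2)
    - Real.pi / 2 * ((k : ℝ) ^ 2 * posCoeff k X ^ 2) + _ +
    (Real.pi / 2 * ((k : ℝ) ^ 2 * posCoeff k Y ^ 2)
      + (1 / (4 * ε ^ 2) - 2 * ((N : ℝ) + 1) ^ 2) * (Real.pi / 2 * posCoeff k Y ^ 2) + _)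
  simp only [sinCoeff_mix, mixCoeff_apply, modeEnergy, modeWeight, ep, ev, ex, ex']
  split_ifs <;> ring

/-- The smallest weight in the adapted norm. -/
def minWeight (ε : ℝ) (N : ℕ) : ℝ := 1 / (4 * ε ^ 2) - ((N : ℝ) + 1) ^ 2

theorem minWeight_pos {ε : ℝ} (hε : 0 < ε) {N : ℕ} (h : (N : ℝ) + 1 < 1 / (2 * ε)) :
    0 < minWeight ε N := by
  have h2 : ((N : ℝ) + 1) ^ 2 < (1 / (2 * ε)) ^ 2 := by gcongr
  have h3 : (1 / (2 * ε)) ^ 2 = 1 / (4 * ε ^ 2) := by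
    field_simp; norm_num
  rw [minWeight]
  linarith

/-- Both cases compare `k` with `N + 1`: below it `-k²` exceeds `-(N+1)²`, and above it `k² -
2(N+1)²` does. -/
theorem minWeight_le_modeWeight (ε : ℝ) {N k : ℕ} (hk : 1 ≤ k) :
    minWeight ε N ≤ modeWeight ε N k := by
  rw [minWeight, modeWeight]
  split_ifs with h
  · have : (k : ℝ) ≤ N := by exact_mod_cast (Finset.mem_Icc.1 h).2
    nlinarith
  · have : (N : ℝ) + 1 ≤ k := by
      rw [Finset.mem_Icc] at h
      exact_mod_cast (show N + 1 ≤ k by omega)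
    nlinarith

theorem minWeight_mul_sq_le (ε : ℝ) (N k : ℕ) (U : E) :
    minWeight ε N * posCoeff k U ^ 2 ≤ modeWeight ε N k * posCoeff k U ^ 2 := by
  rcases Nat.eq_zero_or_pos k with h | h
  · simp [h, posCoeff_zero_left]
  · exact mul_le_mul_of_nonneg_right (minWeight_le_modeWeight ε h) (sq_nonneg _)

theorem modeEnergy_nonneg {ε : ℝ} {N : ℕ} (h : 0 < minWeight ε N) (k : ℕ) (U : E) :
    0 ≤ modeEnergy ε N k U := by
  have := minWeight_mul_sq_le ε N k U
  rw [modeEnergy]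
  nlinarith [mul_nonneg h.le (sq_nonneg (posCoeff k U)), sq_nonneg (mixCoeff ε k U)]

theorem minWeight_mul_norm_pos_sq_le (ε : ℝ) (N : ℕ) (U : E) :
    minWeight ε N * ‖pos U‖ ^ 2 ≤ innerE ε N U U := by
  refine hasSum_le (fun k => ?_) ((hasSum_sinCoeff_sq (pos U)).mul_left _)
    (hasSum_modeEnergy ε N U)
  rw [mul_left_comm]
  refine mul_le_mul_of_nonneg_left ?_ (by positivity)
  rw [modeEnergy, ← posCoeff_apply]
  linarith [minWeight_mul_sq_le ε N k U, sq_nonneg (mixCoeff ε k U)]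

theorem innerE_self_nonneg {ε : ℝ} {N : ℕ} (h : 0 < minWeight ε N) (U : E) :
    0 ≤ innerE ε N U U :=
  (hasSum_modeEnergy ε N U).nonneg fun k =>
    mul_nonneg (by positivity) (modeEnergy_nonneg h k U)

theorem normE_sq {ε : ℝ} {N : ℕ} (h : 0 < minWeight ε N) (U : E) :
    normE ε N U ^ 2 = innerE ε N U U := Real.sq_sqrt (innerE_self_nonneg h U)

theorem normE_nonneg (ε : ℝ) (N : ℕ) (U : E) : 0 ≤ normE ε N U := Real.sqrt_nonneg _

theorem innerE_self_smul (ε : ℝ) (N : ℕ) (c : ℝ) (U : E) :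
    innerE ε N (c • U) (c • U) = c ^ 2 * innerE ε N U U := by
  refine (hasSum_modeEnergy ε N (c • U)).unique
    (((hasSum_modeEnergy ε N U).mul_left (c ^ 2)).congr_fun fun k => ?_)
  simp only [modeEnergy, map_smul, smul_eq_mul]
  ring

theorem normE_smul (ε : ℝ) (N : ℕ) (c : ℝ) (U : E) :
    normE ε N (c • U) = |c| * normE ε N U := by
  rw [normE, innerE_self_smul, Real.sqrt_mul (sq_nonneg c), Real.sqrt_sq_eq_abs, normE]

/-- The crude factor `2` is harmless: it enters only qualitative growth bounds and the final
constant. The contraction step uses the triangle inequality of `L2` instead. -/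
theorem normE_add_le {ε : ℝ} {N : ℕ} (h : 0 < minWeight ε N) (U V : E) :
    normE ε N (U + V) ≤ 2 * (normE ε N U + normE ε N V) := by
  have hsum : innerE ε N (U + V) (U + V) ≤ 2 * innerE ε N U U + 2 * innerE ε N V V := by
    refine hasSum_le (fun k => ?_) (hasSum_modeEnergy ε N (U + V))
      (((hasSum_modeEnergy ε N U).mul_left 2).add ((hasSum_modeEnergy ε N V).mul_left 2))
    have h1 := minWeight_mul_sq_le ε N k (U - V)
    have h2 := mul_nonneg h.le (sq_nonneg (posCoeff k (U - V)))
    have h3 := mul_nonneg (show 0 ≤ Real.pi / 2 by positivity)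
      (add_nonneg (h2.trans h1) (sq_nonneg (mixCoeff ε k (U - V))))
    simp only [modeEnergy, map_add, map_sub] at h3 ⊢
    linarith
  rw [← normE_sq h, ← normE_sq h, ← normE_sq h] at hsum
  have hU := normE_nonneg ε N U
  have hV := normE_nonneg ε N V
  refine (pow_le_pow_iff_left₀ (normE_nonneg _ _ _) (by positivity) two_ne_zero).1 ?_
  nlinarith [mul_nonneg hU hV, sq_nonneg (normE ε N U), sq_nonneg (normE ε N V)]

theorem normE_sub_le {ε : ℝ} {N : ℕ} (h : 0 < minWeight ε N) (U V : E) :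
    normE ε N (U - V) ≤ 2 * (normE ε N U + normE ε N V) := by
  have h1 := normE_add_le h U ((-1 : ℝ) • V)
  rw [normE_smul] at h1
  have h2 : U + (-1 : ℝ) • V = U - V := by module
  rwa [abs_neg, abs_one, one_mul, h2] at h1

/-- This is the source of the square root in the gap condition, because `ε √(minWeight ε N) = √(1/4
- ε² (N+1)²)`. -/
theorem norm_pos_le {ε : ℝ} {N : ℕ} (h : 0 < minWeight ε N) (U : E) :
    ‖pos U‖ ≤ normE ε N U / √(minWeight ε N) := by
  rw [le_div_iff₀ (Real.sqrt_pos.2 h)]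
  refine Real.le_sqrt_of_sq_le ?_
  rw [mul_pow, Real.sq_sqrt h.le, mul_comm]
  exact minWeight_mul_norm_pos_sq_le ε N U

/-! ### The spectral splitting in terms of sine coefficients -/

/-- Half the separation of the two eigenvalues of the `k`-th mode, times `ε`. -/
def modeRoot (ε : ℝ) (k : ℕ) : ℝ := √(1 / (4 * ε ^ 2) - (k : ℝ) ^ 2)

theorem sqrt_eq_modeRoot {ε : ℝ} (hε : 0 < ε) (k : ℕ) :
    √(1 - 4 * ε ^ 2 * (k : ℝ) ^ 2) = 2 * ε * modeRoot ε k := by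
  rw [modeRoot, ← Real.sqrt_sq (show 0 ≤ 2 * ε by positivity), ← Real.sqrt_mul (sq_nonneg _)]
  congr 1
  field_simp
  ring

theorem lamPlus_eq {ε : ℝ} (hε : 0 < ε) (k : ℕ) :
    lamPlus ε k = -1 / (2 * ε ^ 2) + modeRoot ε k / ε := by
  rw [lamPlus, sqrt_eq_modeRoot hε]
  field_simp

theorem lamMinus_eq {ε : ℝ} (hε : 0 < ε) (k : ℕ) :
    lamMinus ε k = -1 / (2 * ε ^ 2) - modeRoot ε k / ε := by
  rw [lamMinus, sqrt_eq_modeRoot hε]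
  field_simp

theorem modeRoot_antitone (ε : ℝ) : Antitone (modeRoot ε) := by
  intro j k hjk
  rw [modeRoot, modeRoot]
  gcongr

/-- Twice the component of the `k`-th mode along `e_k⁺`, suitably scaled. -/
def plusCoeff (ε : ℝ) (k : ℕ) : E →L[ℝ] ℝ := modeRoot ε k • posCoeff k + mixCoeff ε k

theorem plusCoeff_apply (ε : ℝ) (k : ℕ) (U : E) :
    plusCoeff ε k U = modeRoot ε k * posCoeff k U + mixCoeff ε k U := rfl

/-- On `e_k⁻` the mixed coefficient is `1 / (2ε) + ε λ_k⁻ = -modeRoot ε k`, which cancels the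
position term; on `E₂₂` the modes `k ≤ N` vanish. -/
theorem plusCoeff_eq_zero_of_mem_E2 {ε : ℝ} (hε : 0 < ε) {N : ℕ} {U : E} (hU : U ∈ E2 ε N)
    {k : ℕ} (hk : k ∈ Set.Icc 1 N) : plusCoeff ε k U = 0 := by
  have hle : E2 ε N ≤ LinearMap.ker (plusCoeff ε k).toLinearMap := by
    refine sup_le (Submodule.span_le.2 ?_) ?_
    · rintro _ ⟨j, hj, rfl⟩
      have h1 : posCoeff k (eMinus ε j) = if k = j then 1 else 0 := sinCoeff_sinL2 k hj.1
      have h2 : velCoeff k (eMinus ε j) = lamMinus ε j * if k = j then 1 else 0 := by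
        change sinCoeffL k (lamMinus ε j • sinL2 j) = _
        rw [map_smul, sinCoeffL_apply, sinCoeff_sinL2 k hj.1, smul_eq_mul]
      change plusCoeff ε k (eMinus ε j) = 0
      rw [plusCoeff_apply, mixCoeff_apply, h1, h2]
      split_ifs with h
      · rw [h, lamMinus_eq hε]
        field_simp
        ring
      · simp
    · intro V hV
      obtain ⟨h1, h2⟩ := hV k hk
      change plusCoeff ε k V = 0
      rw [plusCoeff_apply, mixCoeff_apply, posCoeff_apply, velCoeff_apply, h1, h2]
      simp
  exact hle hU

/-! ### Two differential inequalities on a half line -/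

/-- A Gronwall inequality started at `-∞`: the a priori growth bound replaces an initial value, and
its constant `C` disappears from the conclusion. -/
theorem le_of_deriv_le_of_le_exp {Q Q' : ℝ → ℝ} {η ν A C : ℝ} (hν : 0 < ν)
    (hc : ContinuousOn Q (Iic 0)) (hd : ∀ t < 0, HasDerivAt Q (Q' t) t)
    (hQ : ∀ t < 0, Q' t ≤ (2 * η - ν) * Q t + A * Real.exp (2 * η * t))
    (hb : ∀ t ≤ 0, Q t ≤ C * Real.exp (2 * η * t)) {t : ℝ} (ht : t ≤ 0) :
    Q t ≤ A / ν * Real.exp (2 * η * t) := by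
  -- The integrating factor is applied and the particular solution `A / ν · e^{2ηt}` subtracted. `F`
  -- is then decreasing, and the growth bound makes its upper limit at `-∞` at most `0`.
  set F : ℝ → ℝ := fun t => Q t * Real.exp (-(2 * η - ν) * t) - A / ν * Real.exp (ν * t) with hF
  have hFd : ∀ t < 0, HasDerivAt F (Q' t * Real.exp (-(2 * η - ν) * t) +
      Q t * (Real.exp (-(2 * η - ν) * t) * -(2 * η - ν)) -
        A / ν * (Real.exp (ν * t) * ν)) t := by
    intro t ht
    have e1 : HasDerivAt (fun t => Real.exp (-(2 * η - ν) * t))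
        (Real.exp (-(2 * η - ν) * t) * -(2 * η - ν)) t := by
      simpa using ((hasDerivAt_id t).const_mul (-(2 * η - ν))).exp
    have e2 : HasDerivAt (fun t => Real.exp (ν * t)) (Real.exp (ν * t) * ν) t := by
      simpa using ((hasDerivAt_id t).const_mul ν).exp
    exact ((hd t ht).mul e1).sub (e2.const_mul (A / ν))
  have hFc : ContinuousOn F (Iic 0) :=
    (hc.mul (Continuous.continuousOn (by fun_prop))).sub (Continuous.continuousOn (by fun_prop))
  have hanti : AntitoneOn F (Iic 0) := by
    refine antitoneOn_of_deriv_nonpos (convex_Iic 0) hFc ?_ ?_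
    · rw [interior_Iic]
      exact fun t ht => (hFd t ht).differentiableAt.differentiableWithinAt
    · rw [interior_Iic]
      intro t ht
      rw [(hFd t ht).deriv]
      have h1 := mul_le_mul_of_nonneg_right (hQ t ht) (Real.exp_pos (-(2 * η - ν) * t)).le
      have h2 : Real.exp (2 * η * t) * Real.exp (-(2 * η - ν) * t) = Real.exp (ν * t) := by
        rw [← Real.exp_add]; ring_nf
      have h3 : A / ν * (Real.exp (ν * t) * ν) = A * Real.exp (ν * t) := by field_simp
      rw [h3, ← h2]
      linarith
  have hlim : Tendsto (fun s => (C - A / ν) * Real.exp (ν * s)) atBot (𝓝 0) := by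
    have := (Real.tendsto_exp_atBot.comp (tendsto_id.const_mul_atBot hν)).const_mul (C - A / ν)
    simpa using this
  have hFt : F t ≤ 0 := by
    refine ge_of_tendsto hlim ?_
    filter_upwards [eventually_le_atBot t] with s hs
    refine (hanti (mem_Iic.2 (hs.trans ht)) (mem_Iic.2 ht) hs).trans ?_
    have h1 := mul_le_mul_of_nonneg_right (hb s (hs.trans ht))
      (Real.exp_pos (-(2 * η - ν) * s)).le
    have h2 : Real.exp (2 * η * s) * Real.exp (-(2 * η - ν) * s) = Real.exp (ν * s) := by
      rw [← Real.exp_add]; ring_nf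
    rw [mul_assoc, h2] at h1
    simp only [hF]
    linarith
  have h2 : Real.exp (ν * t) = Real.exp (2 * η * t) * Real.exp (-(2 * η - ν) * t) := by
    rw [← Real.exp_add]; ring_nf
  simp only [hF, h2] at hFt
  refine le_of_mul_le_mul_right ?_ (Real.exp_pos (-(2 * η - ν) * t))
  linarith

/-- The backward counterpart: the value at time `0` is known, and a lower bound on the derivative
limits the size at earlier times. -/
theorem le_of_le_deriv_of_zero {P P' : ℝ → ℝ} {η μ A : ℝ} (hμ : 0 < μ) (hA : 0 ≤ A)
    (hc : ContinuousOn P (Iic 0)) (hd : ∀ t < 0, HasDerivAt P (P' t) t)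
    (hP : ∀ t < 0, (2 * η + μ) * P t - A * Real.exp (2 * η * t) ≤ P' t)
    (h0 : P 0 = 0) {t : ℝ} (ht : t ≤ 0) :
    P t ≤ A / μ * Real.exp (2 * η * t) := by
  -- Here `F` is increasing, and `F 0 = -A / μ ≤ 0`.
  set F : ℝ → ℝ := fun t => P t * Real.exp (-(2 * η + μ) * t) - A / μ * Real.exp (-μ * t) with hF
  have hFd : ∀ t < 0, HasDerivAt F (P' t * Real.exp (-(2 * η + μ) * t) +
      P t * (Real.exp (-(2 * η + μ) * t) * -(2 * η + μ)) -
        A / μ * (Real.exp (-μ * t) * -μ)) t := by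
    intro t ht
    have e1 : HasDerivAt (fun t => Real.exp (-(2 * η + μ) * t))
        (Real.exp (-(2 * η + μ) * t) * -(2 * η + μ)) t := by
      simpa using ((hasDerivAt_id t).const_mul (-(2 * η + μ))).exp
    have e2 : HasDerivAt (fun t => Real.exp (-μ * t)) (Real.exp (-μ * t) * -μ) t := by
      simpa using ((hasDerivAt_id t).const_mul (-μ)).exp
    exact ((hd t ht).mul e1).sub (e2.const_mul (A / μ))
  have hFc : ContinuousOn F (Iic 0) :=
    (hc.mul (Continuous.continuousOn (by fun_prop))).sub (Continuous.continuousOn (by fun_prop))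
  have hmono : MonotoneOn F (Iic 0) := by
    refine monotoneOn_of_deriv_nonneg (convex_Iic 0) hFc ?_ ?_
    · rw [interior_Iic]
      exact fun t ht => (hFd t ht).differentiableAt.differentiableWithinAt
    · rw [interior_Iic]
      intro t ht
      rw [(hFd t ht).deriv]
      have h1 := mul_le_mul_of_nonneg_right (hP t ht) (Real.exp_pos (-(2 * η + μ) * t)).le
      have h2 : Real.exp (2 * η * t) * Real.exp (-(2 * η + μ) * t) = Real.exp (-μ * t) := by
        rw [← Real.exp_add]; ring_nf
      have h3 : A / μ * (Real.exp (-μ * t) * -μ) = -(A * Real.exp (-μ * t)) := by field_simp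
      rw [h3, ← h2]
      linarith
  have hFt := hmono (mem_Iic.2 ht) (mem_Iic.2 le_rfl) ht
  have h2 : Real.exp (-μ * t) = Real.exp (2 * η * t) * Real.exp (-(2 * η + μ) * t) := by
    rw [← Real.exp_add]; ring_nf
  have h3 : 0 ≤ A / μ := div_nonneg hA hμ.le
  simp only [hF, h2, h0, mul_zero, Real.exp_zero, mul_one, zero_sub] at hFt
  refine le_of_mul_le_mul_right ?_ (Real.exp_pos (-(2 * η + μ) * t))
  linarith

/-! ### Energy inequalities for one mode -/

/-- The contribution of the `k`-th mode to the square of the adapted norm of the component in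
`E₂`. -/
def stableEnergy (ε : ℝ) (N k : ℕ) (U : E) : ℝ :=
  if k ∈ Finset.Icc 1 N then (modeRoot ε k * posCoeff k U - mixCoeff ε k U) ^ 2 / 2
  else modeEnergy ε N k U

theorem modeRoot_sq {ε : ℝ} {N k : ℕ} (h : 0 < minWeight ε N) (hk : k ∈ Finset.Icc 1 N) :
    modeRoot ε k ^ 2 = modeWeight ε N k := by
  have h1 := minWeight_le_modeWeight ε (N := N) (Finset.mem_Icc.1 hk).1
  rw [modeWeight, if_pos hk] at h1 ⊢
  exact Real.sq_sqrt (h.le.trans h1)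

/-- For `k ≤ N` this is the parallelogram identity with `r = modeRoot ε k`: `r² u² + m² = ((r u +
m)² + (r u - m)²) / 2`. It makes `E₁` and `E₋₁` orthogonal in the adapted norm. -/
theorem modeEnergy_eq_add {ε : ℝ} {N : ℕ} (h : 0 < minWeight ε N) (k : ℕ) (U : E) :
    modeEnergy ε N k U =
      (if k ∈ Finset.Icc 1 N then plusCoeff ε k U ^ 2 / 2 else 0) + stableEnergy ε N k U := by
  rw [stableEnergy]
  split_ifs with hk
  · rw [modeEnergy, ← modeRoot_sq h hk, plusCoeff_apply]
    ring
  · simp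

theorem stableEnergy_le {ε : ℝ} {N : ℕ} (h : 0 < minWeight ε N) (k : ℕ) (U : E) :
    stableEnergy ε N k U ≤ modeEnergy ε N k U := by
  rw [modeEnergy_eq_add h]
  have : 0 ≤ (if k ∈ Finset.Icc 1 N then plusCoeff ε k U ^ 2 / 2 else 0) := by positivity
  linarith

theorem young_mul_le {a b c : ℝ} (hc : 0 < c) : 2 * (a * b) ≤ c * a ^ 2 + b ^ 2 / c := by
  have h : c * a ^ 2 + b ^ 2 / c - 2 * (a * b) = (c * a - b) ^ 2 / c := by
    field_simp; ring
  have : 0 ≤ (c * a - b) ^ 2 / c := by positivity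
  linarith

/-- The equation of the damped wave equation for the `k`-th mode, as a first order system for the
coefficients of `u` and `u / (2 ε) + ε v`. -/
def HasModeDeriv (ε : ℝ) (k : ℕ) (D : ℝ → E) (γ t : ℝ) : Prop :=
  HasDerivAt (fun t => posCoeff k (D t))
    (-posCoeff k (D t) / (2 * ε ^ 2) + mixCoeff ε k (D t) / ε) t ∧
  HasDerivAt (fun t => mixCoeff ε k (D t))
    (-mixCoeff ε k (D t) / (2 * ε ^ 2)
      + (1 / (4 * ε ^ 2) - (k : ℝ) ^ 2) * posCoeff k (D t) / ε + γ / ε) t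

theorem minWeight_sqrt (ε : ℝ) (N : ℕ) : √(minWeight ε N) = modeRoot ε (N + 1) := by
  rw [minWeight, modeRoot]
  push_cast
  rfl

/-- The adapted norm is designed so that no mode of `E₂` grows faster than `λ_{N+1}⁺`. Low modes are
eigendirections of rate `λ_k⁻`; for high modes the weight leaves a cross term which the energy
absorbs at exactly this rate. -/
theorem HasModeDeriv.stableEnergy {ε : ℝ} (hε : 0 < ε) {N k : ℕ} (h : 0 < minWeight ε N)
    {D : ℝ → E} {γ t ν : ℝ} (hν : 0 < ν) (hD : HasModeDeriv ε k D γ t) :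
    ∃ e, HasDerivAt (fun t => stableEnergy ε N k (D t)) e t ∧
      e ≤ (2 * lamPlus ε (N + 1) + ν) * stableEnergy ε N k (D t) + γ ^ 2 / (ε ^ 2 * ν) := by
  obtain ⟨hu, hm⟩ := hD
  set u := posCoeff k (D t)
  set m := mixCoeff ε k (D t)
  have hγ : 0 ≤ γ ^ 2 / (ε ^ 2 * ν) := by positivity
  have hγ' : (γ / ε) ^ 2 / ν = γ ^ 2 / (ε ^ 2 * ν) := by field_simp
  by_cases hk : k ∈ Finset.Icc 1 N
  · simp only [DampedWave.stableEnergy, if_pos hk]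
    refine ⟨_, (((hu.const_mul (modeRoot ε k)).sub hm).pow 2).div_const 2, ?_⟩
    have hr := modeRoot_sq h hk
    rw [modeWeight, if_pos hk] at hr
    have hy := young_mul_le (a := -(modeRoot ε k * u - m)) (b := γ / ε) hν
    rw [hγ'] at hy
    -- The left side is `λ_k⁻`.
    have hl : -1 / (2 * ε ^ 2) - modeRoot ε k / ε ≤ lamPlus ε (N + 1) := by
      rw [lamPlus_eq hε]
      have h1 : 0 ≤ modeRoot ε k / ε := div_nonneg (Real.sqrt_nonneg _) hε.le
      have h2 : 0 ≤ modeRoot ε (N + 1) / ε := div_nonneg (Real.sqrt_nonneg _) hε.le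
      linarith
    have hl2 := mul_le_mul_of_nonneg_right hl (sq_nonneg (modeRoot ε k * u - m))
    have hν2 := mul_nonneg hν.le (sq_nonneg (modeRoot ε k * u - m))
    rw [← hr]
    change ((2 : ℕ) : ℝ) * (modeRoot ε k * u - m) ^ (2 - 1) * _ / 2 ≤
      (2 * lamPlus ε (N + 1) + ν) * ((modeRoot ε k * u - m) ^ 2 / 2) + _
    have e : ((2 : ℕ) : ℝ) * (modeRoot ε k * u - m) ^ (2 - 1) *
        (modeRoot ε k * (-u / (2 * ε ^ 2) + m / ε) -
          (-m / (2 * ε ^ 2) + modeRoot ε k ^ 2 * u / ε + γ / ε)) / 2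
        = (-1 / (2 * ε ^ 2) - modeRoot ε k / ε) * (modeRoot ε k * u - m) ^ 2
          + -(modeRoot ε k * u - m) * (γ / ε) := by
      push_cast
      field_simp
      ring
    rw [e]
    linarith
  · rcases Nat.eq_zero_or_pos k with h0 | h0
    -- The index `0` carries no mode: all its coefficients vanish, whatever the sign of its weight.
    · subst h0
      refine ⟨0, ?_, ?_⟩
      · have : (fun t => DampedWave.stableEnergy ε N 0 (D t)) = fun _ => 0 := by
          ext t
          simp [DampedWave.stableEnergy, modeEnergy, posCoeff_zero_left, mixCoeff_zero_left]
        rw [this]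
        exact hasDerivAt_const t 0
      · simpa [DampedWave.stableEnergy, modeEnergy, posCoeff_zero_left, mixCoeff_zero_left]
          using hγ
    · simp only [DampedWave.stableEnergy, if_neg hk, modeEnergy]
      refine ⟨_, ((hu.pow 2).const_mul (modeWeight ε N k)).add (hm.pow 2), ?_⟩
      have hw := minWeight_le_modeWeight ε (N := N) h0
      set s := modeRoot ε (N + 1) with hs
      have hs2 : s ^ 2 = minWeight ε N := by
        rw [hs, ← minWeight_sqrt, Real.sq_sqrt h.le]
      have hs0 : 0 ≤ s := Real.sqrt_nonneg _
      have hW : modeWeight ε N k = 2 * s ^ 2 - (1 / (4 * ε ^ 2) - (k : ℝ) ^ 2) := by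
        rw [hs2, minWeight, modeWeight, if_neg hk]; ring
      have hy := young_mul_le (a := m) (b := γ / ε) hν
      rw [hγ'] at hy
      rw [lamPlus_eq hε, ← hs]
      -- The cross term `4 s² u m / ε` is at most `2 (s / ε) (s² u² + m²)`, and `s²` is at most the
      -- weight. Hence the rate `-1 / ε² + 2 s / ε = 2 λ_{N+1}⁺`.
      have h1 : 0 ≤ (s * u - m) ^ 2 * (s / ε) := by positivity
      have h2 : 0 ≤ (modeWeight ε N k - s ^ 2) * u ^ 2 * (s / ε) := by
        rw [hs2]
        exact mul_nonneg (mul_nonneg (by linarith) (sq_nonneg u)) (by positivity)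
      have h3 : 0 ≤ ν * (modeWeight ε N k * u ^ 2) :=
        mul_nonneg hν.le (mul_nonneg (h.le.trans hw) (sq_nonneg u))
      set W := modeWeight ε N k
      have hW' : 1 / (4 * ε ^ 2) - (k : ℝ) ^ 2 = 2 * s ^ 2 - W := by linarith
      rw [hW']
      change W * (((2 : ℕ) : ℝ) * u ^ (2 - 1) * (-u / (2 * ε ^ 2) + m / ε)) +
        ((2 : ℕ) : ℝ) * m ^ (2 - 1) * (-m / (2 * ε ^ 2) + (2 * s ^ 2 - W) * u / ε + γ / ε) ≤ _
      have e : W * (((2 : ℕ) : ℝ) * u ^ (2 - 1) * (-u / (2 * ε ^ 2) + m / ε)) +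
          ((2 : ℕ) : ℝ) * m ^ (2 - 1) *
            (-m / (2 * ε ^ 2) + (2 * s ^ 2 - W) * u / ε + γ / ε)
          = 2 * (-1 / (2 * ε ^ 2)) * (W * u ^ 2 + m ^ 2) + 4 * (s ^ 2 * u * m / ε)
            + 2 * (m * (γ / ε)) := by
        push_cast
        field_simp
        ring
      rw [e]
      have e1 : (s * u - m) ^ 2 * (s / ε)
          = s / ε * (s ^ 2 * u ^ 2 + m ^ 2) - 2 * (s ^ 2 * u * m / ε) := by ring
      rw [e1] at h1
      linarith

/-- The component along `e_k⁺` is an eigendirection of rate `λ_k⁺ ≥ λ_N⁺`, since `modeRoot`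
decreases in `k`. -/
theorem HasModeDeriv.plusCoeff_sq {ε : ℝ} (hε : 0 < ε) {N k : ℕ} (h : 0 < minWeight ε N)
    (hk : k ∈ Finset.Icc 1 N) {D : ℝ → E} {γ t μ : ℝ} (hμ : 0 < μ)
    (hD : HasModeDeriv ε k D γ t) :
    ∃ e, HasDerivAt (fun t => plusCoeff ε k (D t) ^ 2 / 2) e t ∧
      (2 * lamPlus ε N - μ) * (plusCoeff ε k (D t) ^ 2 / 2) - γ ^ 2 / (ε ^ 2 * μ) ≤ e := by
  obtain ⟨hu, hm⟩ := hD
  simp only [plusCoeff_apply]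
  set u := posCoeff k (D t)
  set m := mixCoeff ε k (D t)
  have hγ : 0 ≤ γ ^ 2 / (ε ^ 2 * μ) := by positivity
  have hγ' : (γ / ε) ^ 2 / μ = γ ^ 2 / (ε ^ 2 * μ) := by field_simp
  refine ⟨_, (((hu.const_mul (modeRoot ε k)).add hm).pow 2).div_const 2, ?_⟩
  have hr := modeRoot_sq h hk
  rw [modeWeight, if_pos hk] at hr
  have hy := young_mul_le (a := -(modeRoot ε k * u + m)) (b := γ / ε) hμ
  rw [hγ'] at hy
  have hl : lamPlus ε N ≤ -1 / (2 * ε ^ 2) + modeRoot ε k / ε := by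
    rw [lamPlus_eq hε]
    have := modeRoot_antitone ε (Finset.mem_Icc.1 hk).2
    gcongr
  have hl2 := mul_le_mul_of_nonneg_right hl (sq_nonneg (modeRoot ε k * u + m))
  rw [← hr]
  change _ ≤ ((2 : ℕ) : ℝ) * (modeRoot ε k * u + m) ^ (2 - 1) * _ / 2
  have e : ((2 : ℕ) : ℝ) * (modeRoot ε k * u + m) ^ (2 - 1) *
      (modeRoot ε k * (-u / (2 * ε ^ 2) + m / ε) +
        (-m / (2 * ε ^ 2) + modeRoot ε k ^ 2 * u / ε + γ / ε)) / 2
      = (-1 / (2 * ε ^ 2) + modeRoot ε k / ε) * (modeRoot ε k * u + m) ^ 2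
        + (modeRoot ε k * u + m) * (γ / ε) := by
    push_cast
    field_simp
    ring
  rw [e]
  linarith

/-! ### The linear estimate -/

theorem sum_sinCoeff_sq_le (F : Finset ℕ) (g : L2) :
    ∑ k ∈ F, Real.pi / 2 * sinCoeff k g ^ 2 ≤ ‖g‖ ^ 2 :=
  sum_le_hasSum F (fun _ _ => by positivity) (hasSum_sinCoeff_sq g)

theorem sum_stableEnergy_le {ε : ℝ} {N : ℕ} (h : 0 < minWeight ε N) (F : Finset ℕ) (U : E) :
    ∑ k ∈ F, Real.pi / 2 * stableEnergy ε N k U ≤ normE ε N U ^ 2 := by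
  rw [normE_sq h]
  refine (Finset.sum_le_sum fun k _ => ?_).trans (sum_le_hasSum F (fun k _ => ?_)
    (hasSum_modeEnergy ε N U))
  · exact mul_le_mul_of_nonneg_left (stableEnergy_le h k U) (by positivity)
  · exact mul_nonneg (by positivity) (modeEnergy_nonneg h k U)

theorem normE_sq_le_of_forall {ε : ℝ} {N : ℕ} (h : 0 < minWeight ε N) {U : E} {A B : ℝ}
    (hA : ∑ k ∈ Finset.Icc 1 N, Real.pi / 2 * (plusCoeff ε k U ^ 2 / 2) ≤ A)
    (hB : ∀ F : Finset ℕ, ∑ k ∈ F, Real.pi / 2 * stableEnergy ε N k U ≤ B) :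
    normE ε N U ^ 2 ≤ A + B := by
  rw [normE_sq h]
  refine hasSum_le_of_sum_le (hasSum_modeEnergy ε N U) fun F => ?_
  simp_rw [modeEnergy_eq_add h, mul_add, Finset.sum_add_distrib]
  refine add_le_add (le_trans ?_ hA) (hB F)
  simp_rw [mul_ite, mul_zero]
  rw [← Finset.sum_filter]
  refine Finset.sum_le_sum_of_subset_of_nonneg ?_ fun _ _ _ => by positivity
  intro k hk
  exact (Finset.mem_filter.1 hk).2

/-- The linear part of the Lyapunov–Perron argument, by energy inequalities instead of the variation
of constants formula. -/
theorem normE_le_of_hasModeDeriv {ε : ℝ} (hε : 0 < ε) {N : ℕ} (h : 0 < minWeight ε N) {η : ℝ}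
    (hη₁ : lamPlus ε (N + 1) < η) (hη₂ : η < lamPlus ε N) {D : ℝ → E} {g : ℝ → L2} {G C : ℝ}
    (hD : ContinuousOn D (Iic 0))
    (hmode : ∀ t < 0, ∀ k, HasModeDeriv ε k D (sinCoeff k (g t)) t)
    (hG : ∀ t ≤ 0, ‖g t‖ ≤ G * Real.exp (η * t))
    (hC : ∀ t ≤ 0, normE ε N (D t) ≤ C * Real.exp (η * t))
    (h0 : ∀ k ∈ Set.Icc 1 N, plusCoeff ε k (D 0) = 0) {t : ℝ} (ht : t ≤ 0) :
    normE ε N (D t) ≤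
      G / ε * (1 / (lamPlus ε N - η) + 1 / (η - lamPlus ε (N + 1))) * Real.exp (η * t) := by
  -- Each distance to `η` serves also as the parameter in Young's inequality. This spends half of
  -- the doubled gap and leaves squared bounds `(G / (ε μ))²` and `(G / (ε ν))²`.
  set μ := lamPlus ε N - η with hμdef
  set ν := η - lamPlus ε (N + 1) with hνdef
  have hμ : 0 < μ := sub_pos.2 hη₂
  have hν : 0 < ν := sub_pos.2 hη₁
  have hexp : ∀ t : ℝ, Real.exp (η * t) ^ 2 = Real.exp (2 * η * t) := by
    intro t
    rw [← Real.exp_nat_mul]; push_cast; ring_nf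
  have hg : ∀ t ≤ 0, ∀ F : Finset ℕ,
      ∑ k ∈ F, Real.pi / 2 * sinCoeff k (g t) ^ 2 ≤ G ^ 2 * Real.exp (2 * η * t) := by
    intro t ht F
    refine (sum_sinCoeff_sq_le F (g t)).trans ?_
    rw [← hexp, ← mul_pow]
    exact pow_le_pow_left₀ (norm_nonneg _) (hG t ht) 2
  have hG0 : 0 ≤ G := by
    have := (norm_nonneg _).trans (hG 0 le_rfl)
    simpa using this
  have hplus : ∑ k ∈ Finset.Icc 1 N, Real.pi / 2 * (plusCoeff ε k (D t) ^ 2 / 2) ≤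
      G ^ 2 / (ε ^ 2 * μ) / μ * Real.exp (2 * η * t) := by
    have hex : ∀ t < 0, ∃ e,
        HasDerivAt (fun t => ∑ k ∈ Finset.Icc 1 N, Real.pi / 2 * (plusCoeff ε k (D t) ^ 2 / 2))
          e t ∧
        (2 * η + μ) * ∑ k ∈ Finset.Icc 1 N, Real.pi / 2 * (plusCoeff ε k (D t) ^ 2 / 2) -
          G ^ 2 / (ε ^ 2 * μ) * Real.exp (2 * η * t) ≤ e := by
      intro t ht
      choose! e he he' using fun k (hk : k ∈ Finset.Icc 1 N) =>
        (hmode t ht k).plusCoeff_sq hε h hk hμ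
      refine ⟨_, HasDerivAt.fun_sum fun k hk => (he k hk).const_mul (Real.pi / 2), ?_⟩
      have h1 : ∑ k ∈ Finset.Icc 1 N, Real.pi / 2 *
          ((2 * lamPlus ε N - μ) * (plusCoeff ε k (D t) ^ 2 / 2)
            - sinCoeff k (g t) ^ 2 / (ε ^ 2 * μ)) ≤ ∑ k ∈ Finset.Icc 1 N, Real.pi / 2 * e k :=
        Finset.sum_le_sum fun k hk => mul_le_mul_of_nonneg_left (he' k hk) (by positivity)
      refine le_trans ?_ h1
      have h2 := div_le_div_of_nonneg_right (hg t ht.le (Finset.Icc 1 N))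
        (show 0 ≤ ε ^ 2 * μ by positivity)
      have h3 : 2 * lamPlus ε N - μ = 2 * η + μ := by rw [hμdef]; ring
      have h4 : ∑ k ∈ Finset.Icc 1 N, Real.pi / 2 *
          ((2 * lamPlus ε N - μ) * (plusCoeff ε k (D t) ^ 2 / 2)
            - sinCoeff k (g t) ^ 2 / (ε ^ 2 * μ))
          = (2 * η + μ) * ∑ k ∈ Finset.Icc 1 N, Real.pi / 2 * (plusCoeff ε k (D t) ^ 2 / 2)
            - (∑ k ∈ Finset.Icc 1 N, Real.pi / 2 * sinCoeff k (g t) ^ 2) / (ε ^ 2 * μ) := by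
        rw [Finset.mul_sum, Finset.sum_div, ← Finset.sum_sub_distrib]
        refine Finset.sum_congr rfl fun k _ => ?_
        rw [h3]; ring
      rw [h4, div_mul_eq_mul_div]
      linarith
    choose! P' hP' hP'' using hex
    refine le_of_le_deriv_of_zero hμ (by positivity) ?_ hP' hP'' ?_ ht
    · refine continuousOn_finsetSum _ fun k _ => ?_
      exact ((((plusCoeff ε k).continuous.comp_continuousOn hD).pow 2).div_const 2).const_mul _
    · refine Finset.sum_eq_zero fun k hk => ?_
      rw [h0 k (Finset.mem_Icc.1 hk)]; simp
  -- Finite sets of modes, with a bound independent of the set, avoid differentiating an infinite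
  -- series.
  have hstable : ∀ F : Finset ℕ, ∑ k ∈ F, Real.pi / 2 * stableEnergy ε N k (D t) ≤
      G ^ 2 / (ε ^ 2 * ν) / ν * Real.exp (2 * η * t) := by
    intro F
    have hex : ∀ t < 0, ∃ e,
        HasDerivAt (fun t => ∑ k ∈ F, Real.pi / 2 * stableEnergy ε N k (D t)) e t ∧
        e ≤ (2 * η - ν) * ∑ k ∈ F, Real.pi / 2 * stableEnergy ε N k (D t) +
          G ^ 2 / (ε ^ 2 * ν) * Real.exp (2 * η * t) := by
      intro t ht
      choose e he he' using fun k => (hmode t ht k).stableEnergy hε h hν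
      refine ⟨_, HasDerivAt.fun_sum fun k _ => (he k).const_mul (Real.pi / 2), ?_⟩
      have h1 : ∑ k ∈ F, Real.pi / 2 * e k ≤ ∑ k ∈ F, Real.pi / 2 *
          ((2 * lamPlus ε (N + 1) + ν) * stableEnergy ε N k (D t)
            + sinCoeff k (g t) ^ 2 / (ε ^ 2 * ν)) :=
        Finset.sum_le_sum fun k _ => mul_le_mul_of_nonneg_left (he' k) (by positivity)
      refine h1.trans ?_
      have h2 := div_le_div_of_nonneg_right (hg t ht.le F)
        (show 0 ≤ ε ^ 2 * ν by positivity)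
      have h3 : 2 * lamPlus ε (N + 1) + ν = 2 * η - ν := by rw [hνdef]; ring
      have h4 : ∑ k ∈ F, Real.pi / 2 *
          ((2 * lamPlus ε (N + 1) + ν) * stableEnergy ε N k (D t)
            + sinCoeff k (g t) ^ 2 / (ε ^ 2 * ν))
          = (2 * η - ν) * ∑ k ∈ F, Real.pi / 2 * stableEnergy ε N k (D t)
            + (∑ k ∈ F, Real.pi / 2 * sinCoeff k (g t) ^ 2) / (ε ^ 2 * ν) := by
        rw [Finset.mul_sum, Finset.sum_div, ← Finset.sum_add_distrib]
        refine Finset.sum_congr rfl fun k _ => ?_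
        rw [h3]; ring
      rw [h4, div_mul_eq_mul_div]
      linarith
    choose! Q' hQ' hQ'' using hex
    refine le_of_deriv_le_of_le_exp (C := C ^ 2) hν ?_ hQ' hQ'' ?_ ht
    · refine continuousOn_finsetSum _ fun k _ => ContinuousOn.const_mul ?_ _
      have hu := (posCoeff k).continuous.comp_continuousOn hD
      have hm := (mixCoeff ε k).continuous.comp_continuousOn hD
      unfold DampedWave.stableEnergy modeEnergy
      split_ifs
      · exact (((hu.const_mul _).sub hm).pow 2).div_const 2
      · exact ((hu.pow 2).const_mul _).add (hm.pow 2)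
    · intro t ht
      refine (sum_stableEnergy_le h F (D t)).trans ?_
      rw [← hexp, ← mul_pow]
      exact pow_le_pow_left₀ (normE_nonneg _ _ _) (hC t ht) 2
  have hsq := normE_sq_le_of_forall h hplus hstable
  refine (pow_le_pow_iff_left₀ (normE_nonneg _ _ _) (by positivity) two_ne_zero).1 (hsq.trans ?_)
  rw [mul_pow, mul_pow, hexp, ← add_mul]
  refine mul_le_mul_of_nonneg_right ?_ (Real.exp_pos _).le
  -- The sum of the two squares is at most the square of the sum, the form that occurs in the gap
  -- condition.
  have h5 : (G / ε) ^ 2 * (1 / μ + 1 / ν) ^ 2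
      = G ^ 2 / (ε ^ 2 * μ) / μ + G ^ 2 / (ε ^ 2 * ν) / ν + 2 * ((G / ε) ^ 2 * (1 / (μ * ν))) := by
    field_simp
    ring
  rw [h5]
  have : 0 ≤ 2 * ((G / ε) ^ 2 * (1 / (μ * ν))) := by positivity
  linarith

/-! ### Linear equations with a prescribed forcing -/

/-- The curve `D` solves, mode by mode and integrated in time over `(-∞, 0]`, the linear damped
wave equation with forcing `g` and noise `n`. -/
structure IsForcedSolution (ε : ℝ) (g : ℝ → L2) (n : ℝ → ℕ → ℝ) (D : ℝ → E) : Prop where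
  continuousOn : ContinuousOn D (Iic 0)
  continuousOn_forcing : ContinuousOn g (Iic 0)
  position : ∀ s ≤ 0, ∀ t ≤ 0, ∀ k,
    posCoeff k (D t) - posCoeff k (D s) = ∫ r in s..t, velCoeff k (D r)
  velocity : ∀ s ≤ 0, ∀ t ≤ 0, ∀ k,
    ε ^ 2 * (velCoeff k (D t) - velCoeff k (D s)) =
      (∫ r in s..t, (sinCoeffL k (g r) - velCoeff k (D r) - (k : ℝ) ^ 2 * posCoeff k (D r)))
        + (n t k - n s k)

theorem intervalIntegrable_of_continuousOn_Iic {F : Type*} [NormedAddCommGroup F] {h : ℝ → F}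
    (hh : ContinuousOn h (Iic 0)) {s t : ℝ} (hs : s ≤ 0) (ht : t ≤ 0) :
    IntervalIntegrable h volume s t :=
  (hh.mono fun _ hx => (mem_uIcc.1 hx).elim (fun h => h.2.trans ht)
    fun h => h.2.trans hs).intervalIntegrable

namespace IsForcedSolution

variable {ε : ℝ} {g g' : ℝ → L2} {n n' : ℝ → ℕ → ℝ} {D D' : ℝ → E}

theorem continuousOn_velCoeff (h : IsForcedSolution ε g n D) (k : ℕ) :
    ContinuousOn (fun r => velCoeff k (D r)) (Iic 0) :=
  (velCoeff k).continuous.comp_continuousOn h.continuousOn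

theorem continuousOn_integrand (h : IsForcedSolution ε g n D) (k : ℕ) :
    ContinuousOn (fun r => sinCoeffL k (g r) - velCoeff k (D r)
      - (k : ℝ) ^ 2 * posCoeff k (D r)) (Iic 0) :=
  (((sinCoeffL k).continuous.comp_continuousOn h.continuousOn_forcing).sub
    (h.continuousOn_velCoeff k)).sub
    (((posCoeff k).continuous.comp_continuousOn h.continuousOn).const_mul _)

theorem sub (h : IsForcedSolution ε g n D) (h' : IsForcedSolution ε g' n' D') :
    IsForcedSolution ε (fun t => g t - g' t) (fun t k => n t k - n' t k)
      (fun t => D t - D' t) where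
  continuousOn := h.continuousOn.sub h'.continuousOn
  continuousOn_forcing := h.continuousOn_forcing.sub h'.continuousOn_forcing
  position s hs t ht k := by
    have h1 := h.position s hs t ht k
    have h2 := h'.position s hs t ht k
    simp only [map_sub]
    rw [intervalIntegral.integral_sub
      (intervalIntegrable_of_continuousOn_Iic (h.continuousOn_velCoeff k) hs ht)
      (intervalIntegrable_of_continuousOn_Iic (h'.continuousOn_velCoeff k) hs ht)]
    linarith
  velocity s hs t ht k := by
    have h1 := h.velocity s hs t ht k
    have h2 := h'.velocity s hs t ht k
    have h3 := intervalIntegral.integral_sub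
      (intervalIntegrable_of_continuousOn_Iic (h.continuousOn_integrand k) hs ht)
      (intervalIntegrable_of_continuousOn_Iic (h'.continuousOn_integrand k) hs ht)
    have h4 : ∀ r, sinCoeffL k (g r - g' r) - velCoeff k (D r - D' r)
        - (k : ℝ) ^ 2 * posCoeff k (D r - D' r)
        = (sinCoeffL k (g r) - velCoeff k (D r) - (k : ℝ) ^ 2 * posCoeff k (D r))
          - (sinCoeffL k (g' r) - velCoeff k (D' r) - (k : ℝ) ^ 2 * posCoeff k (D' r)) := by
      intro r
      simp only [map_sub]
      ring
    simp only [h4, h3]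
    simp only [map_sub]
    linarith

theorem const_smul (h : IsForcedSolution ε g n D) (c : ℝ) :
    IsForcedSolution ε (fun t => c • g t) (fun t k => c * n t k) (fun t => c • D t) where
  continuousOn := h.continuousOn.const_smul c
  continuousOn_forcing := h.continuousOn_forcing.const_smul c
  position s hs t ht k := by
    have h1 := h.position s hs t ht k
    simp only [map_smul, smul_eq_mul]
    rw [intervalIntegral.integral_const_mul, ← h1]
    ring
  velocity s hs t ht k := by
    have h1 := h.velocity s hs t ht k
    have h4 : ∀ r, sinCoeffL k (c • g r) - velCoeff k (c • D r)
        - (k : ℝ) ^ 2 * posCoeff k (c • D r)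
        = c * (sinCoeffL k (g r) - velCoeff k (D r) - (k : ℝ) ^ 2 * posCoeff k (D r)) := by
      intro r
      simp only [map_smul, smul_eq_mul]
      ring
    simp only [h4, intervalIntegral.integral_const_mul]
    simp only [map_smul, smul_eq_mul]
    linear_combination c * h1

/-- Without noise the integrated equations have continuous integrands, so each coefficient is
differentiable at negative times by the fundamental theorem of calculus. -/
theorem hasModeDeriv (hε : 0 < ε) (h : IsForcedSolution ε g n D) (hn : ∀ t k, n t k = 0)
    {t : ℝ} (ht : t < 0) (k : ℕ) : HasModeDeriv ε k D (sinCoeff k (g t)) t := by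
  have key : ∀ (y w : ℝ → ℝ), ContinuousOn w (Iic 0) →
      (∀ s ≤ 0, ∀ t ≤ 0, y t - y s = ∫ r in s..t, w r) → HasDerivAt y (w t) t := by
    intro y w hw hy
    have hnhds : Iic (0 : ℝ) ∈ 𝓝 t := Iic_mem_nhds ht
    have h1 : HasDerivAt (fun τ => y t + ∫ r in t..τ, w r) (w t) t := by
      refine (intervalIntegral.integral_hasDerivAt_right IntervalIntegrable.refl ?_
        (hw.continuousAt hnhds)).const_add (y t)
      exact ⟨Iic 0, hnhds, hw.aestronglyMeasurable measurableSet_Iic⟩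
    refine h1.congr_of_eventuallyEq ?_
    filter_upwards [hnhds] with τ hτ
    rw [← hy t ht.le τ hτ]
    ring
  have hu := key _ _ (h.continuousOn_velCoeff k)
    (fun s hs t ht => h.position s hs t ht k)
  have hv := key (fun t => ε ^ 2 * velCoeff k (D t)) _ (h.continuousOn_integrand k)
    (fun s hs t ht => by
      have := h.velocity s hs t ht k
      rw [hn, hn, sub_zero, add_zero] at this
      rw [← this]; ring)
  have hv' : HasDerivAt (fun t => velCoeff k (D t)) _ t :=
    (hv.const_mul (1 / ε ^ 2)).congr_of_eventuallyEq
      (Eventually.of_forall fun t => by field_simp)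
  refine ⟨hu.congr_deriv ?_, ((hu.const_mul (1 / (2 * ε))).add
    (hv'.const_mul ε)).congr_deriv ?_⟩
  · rw [mixCoeff_apply]
    field_simp
    ring
  · rw [mixCoeff_apply, sinCoeffL_apply]
    field_simp
    ring

end IsForcedSolution

/-- The weak equation is tested with `sin (kx)` and multiplied by `2 / π`; `inner_posx_cos` turns
the derivative term into `k²` times the coefficient of `u`. -/
theorem IsSolution.isForcedSolution {ε δ : ℝ} {f : L2 → L2} (hf : Continuous f) {φ : H10}
    {w : ℝ → ℝ} {U : ℝ → E} (hU : IsSolution ε δ f φ w (Iic 0) U) :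
    IsForcedSolution ε (fun t => f (pos (U t))) (fun t k => δ * w t * sinCoeff k φ.1.1) U where
  continuousOn := hU.continuousOn
  continuousOn_forcing := hf.comp_continuousOn (Continuous.comp_continuousOn
    (g := fun U : E => pos U) (by fun_prop) hU.continuousOn)
  position s hs t ht k := by
    have hv : ContinuousOn (fun r => vel (U r)) (Iic 0) :=
      Continuous.comp_continuousOn (g := fun U : E => vel U) (by fun_prop) hU.continuousOn
    have h1 := congrArg (sinCoeffL k) (hU.position s hs t ht)
    rw [← ContinuousLinearMap.intervalIntegral_comp_comm _
      (intervalIntegrable_of_continuousOn_Iic hv hs ht), map_sub] at h1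
    exact h1
  velocity s hs t ht k := by
    have hv : ContinuousOn (fun r => velCoeff k (U r)) (Iic 0) :=
      (velCoeff k).continuous.comp_continuousOn hU.continuousOn
    have hp : ContinuousOn (fun r => posCoeff k (U r)) (Iic 0) :=
      (posCoeff k).continuous.comp_continuousOn hU.continuousOn
    have hg : ContinuousOn (fun r => sinCoeffL k (f (pos (U r)))) (Iic 0) :=
      (sinCoeffL k).continuous.comp_continuousOn (hf.comp_continuousOn
        (Continuous.comp_continuousOn (g := fun U : E => pos U) (by fun_prop) hU.continuousOn))
    have h1 := congrArg (2 / Real.pi * ·) (hU.velocity s hs t ht (sinH10 k))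
    have e1 : ∀ g : L2, inner ℝ g (sinH10 k).1.1 = Real.pi / 2 * sinCoeffL k g := by
      intro g
      rw [sinCoeffL_apply, sinCoeff, real_inner_comm]
      change inner ℝ (sinL2 k) g = _
      field_simp
    have e2 : ∀ r, inner ℝ (posx (U r)) (sinH10 k).1.2
        = Real.pi / 2 * ((k : ℝ) ^ 2 * posCoeff k (U r)) := by
      intro r
      have h2 := inner_posx_cos (U r).1 k
      have h3 : (sinH10 k).1.2 = toL2 (fun x => k * Real.cos (k * x)) (by fun_prop) := rfl
      rw [h3, toL2_eq_of_forall (b := fun x => Real.cos (k * x))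
        (c := fun x => Real.cos (k * x)) _ (by fun_prop) (by fun_prop) k 0 (by simp),
        zero_smul, add_zero, inner_smul_right, h2, posCoeff_apply, sinCoeff]
      field_simp
    simp only [e1, e2, ← mul_add, intervalIntegral.integral_const_mul, map_sub] at h1
    have h5 := intervalIntegral.integral_sub
      (intervalIntegrable_of_continuousOn_Iic hg hs ht)
      (intervalIntegrable_of_continuousOn_Iic (hv.add (hp.const_mul ((k : ℝ) ^ 2))) hs ht)
    simp only [Pi.add_apply] at h5
    have h6 : ∀ r, sinCoeffL k (f (pos (U r))) - velCoeff k (U r)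
        - (k : ℝ) ^ 2 * posCoeff k (U r) = sinCoeffL k (f (pos (U r)))
          - (velCoeff k (U r) + (k : ℝ) ^ 2 * posCoeff k (U r)) := fun r => by ring
    have h7 : ∀ V : E, sinCoeffL k (vel V) = velCoeff k V := fun _ => rfl
    simp only [h7] at h1
    simp only [h6, h5, ← sinCoeffL_apply]
    have hπ := Real.pi_pos.ne'
    field_simp at h1
    linear_combination h1

/-! ### Comparison of the manifolds -/

/-- Solutions of the Lyapunov–Perron problem: solutions on `(-∞, 0]` of growth rate `η`. -/
structure IsBackwardSolution (ε δ : ℝ) (f : L2 → L2) (φ : H10) (N : ℕ) (η : ℝ) (w : ℝ → ℝ)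
    (U : ℝ → E) : Prop where
  isSolution : IsSolution ε δ f φ w (Iic 0) U
  bounded : ∃ C : ℝ, ∀ t ≤ 0, normE ε N (U t) ≤ C * Real.exp (η * t)

theorem exists_isBackwardSolution {ε δ : ℝ} {f : L2 → L2} {φ : H10} {N : ℕ} {η : ℝ} {w : ℝ → ℝ}
    {U₀ : E} (h : U₀ ∈ lpManifold ε δ f φ N η w) :
    ∃ U, IsBackwardSolution ε δ f φ N η w U ∧ U 0 = U₀ := by
  obtain ⟨U, hU, h0, C, hC⟩ := h
  refine ⟨U, ⟨hU, C, fun t ht => ?_⟩, h0⟩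
  have h1 := mul_le_mul_of_nonneg_right (hC t ht) (Real.exp_pos (η * t)).le
  rwa [mul_right_comm, ← Real.exp_add, neg_mul, neg_add_cancel, Real.exp_zero, one_mul] at h1

theorem exp_bound_sub {ε : ℝ} {N : ℕ} (h : 0 < minWeight ε N) {η : ℝ} {U V : ℝ → E}
    (hU : ∃ C : ℝ, ∀ t ≤ 0, normE ε N (U t) ≤ C * Real.exp (η * t))
    (hV : ∃ C : ℝ, ∀ t ≤ 0, normE ε N (V t) ≤ C * Real.exp (η * t)) :
    ∃ C : ℝ, ∀ t ≤ 0, normE ε N (U t - V t) ≤ C * Real.exp (η * t) := by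
  obtain ⟨A, hA⟩ := hU
  obtain ⟨B, hB⟩ := hV
  refine ⟨2 * (A + B), fun t ht => (normE_sub_le h _ _).trans ?_⟩
  linarith [hA t ht, hB t ht]

/-- A quantity that is bounded, and improves every bound by the affine map `B ↦ κ B + b` with
`κ < 1`, is bounded by `b / (1 - κ)`. -/
theorem le_of_forall_bound_improves {ι : Type*} {x : ι → ℝ} {κ b B₀ : ℝ} (hκ : κ < 1)
    (h₀ : ∀ i, x i ≤ B₀) (h : ∀ B, (∀ i, x i ≤ B) → ∀ i, x i ≤ κ * B + b) (i : ι) :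
    x i ≤ b / (1 - κ) := by
  have : Nonempty ι := ⟨i⟩
  have hb : BddAbove (range x) := ⟨B₀, by rintro _ ⟨j, rfl⟩; exact h₀ j⟩
  -- Improving the least bound cannot lower it; `B₀` only guarantees that it is finite.
  have h1 : ⨆ j, x j ≤ κ * (⨆ j, x j) + b := ciSup_le (h _ (le_ciSup hb))
  rw [le_div_iff₀ (by linarith)]
  have h2 := le_ciSup hb i
  nlinarith

/-- The reference pair `U₁`, `V₁` plays the role of a stationary solution of the linear noisy
equation. The noise cancels identically in `D`, so no regularity of the path `w` enters. -/
theorem exists_normE_sub_le {f : L2 → L2} {L : NNReal} (hf : LipschitzWith L f) {φ : H10}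
    {N : ℕ} {ε : ℝ} (hε : 0 < ε) (h : 0 < minWeight ε N) {η : ℝ}
    (hη₁ : lamPlus ε (N + 1) < η) (hη₂ : η < lamPlus ε N)
    (hgap : (L : ℝ) / √(1 / 4 - ε ^ 2 * ((N : ℝ) + 1) ^ 2) *
      (1 / (lamPlus ε N - η) + 1 / (η - lamPlus ε (N + 1))) < 1)
    {w : ℝ → ℝ} {U₁ V₁ : ℝ → E} (hU₁ : IsBackwardSolution ε 1 f φ N η w U₁)
    (hV₁ : IsBackwardSolution ε 0 f φ N η 0 V₁) (h₁ : U₁ 0 - V₁ 0 ∈ E2 ε N) :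
    ∃ c : ℝ, ∀ δ : ℝ, 0 < δ → ∀ U V : ℝ → E, IsBackwardSolution ε δ f φ N η w U →
      IsBackwardSolution ε 0 f φ N η 0 V → U 0 - V 0 ∈ E2 ε N →
      normE ε N (U 0 - V 0) ≤ δ * c := by
  set κ' : ℝ := 1 / (lamPlus ε N - η) + 1 / (η - lamPlus ε (N + 1)) with hκ'
  have hκ'0 : 0 < κ' := add_pos (one_div_pos.2 (by linarith)) (one_div_pos.2 (by linarith))
  set s := √(minWeight ε N) with hs
  have hs0 : 0 < s := Real.sqrt_pos.2 h
  have hroot : √(1 / 4 - ε ^ 2 * ((N : ℝ) + 1) ^ 2) = ε * s := by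
    rw [hs, ← Real.sqrt_sq hε.le, ← Real.sqrt_mul (sq_nonneg _), Real.sqrt_sq hε.le, minWeight]
    congr 1
    field_simp
  rw [hroot] at hgap
  set κ : ℝ := (L : ℝ) / (ε * s) * κ' with hκ
  have hκ0 : 0 ≤ κ := by positivity
  set Z : ℝ → E := fun t => U₁ t - V₁ t with hZ
  obtain ⟨z, hz⟩ := exp_bound_sub h hU₁.bounded hV₁.bounded
  have hz0 : 0 ≤ z := by
    have := (normE_nonneg _ _ _).trans (hz 0 le_rfl)
    simpa using this
  have hposZ : ∀ t ≤ 0, ‖pos (Z t)‖ ≤ z / s * Real.exp (η * t) := by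
    intro t ht
    refine (norm_pos_le h _).trans ?_
    rw [div_mul_eq_mul_div]
    exact div_le_div_of_nonneg_right (hz t ht) hs0.le
  -- `δ * b` is the fixed point of `B ↦ κ B + κ (2 δ z / s)`, the improvement obtained below for
  -- bounds on the first component of `D`.
  set b := 2 * κ * (z / s) / (1 - κ) with hb
  have hκ1 : 0 < 1 - κ := by linarith
  have hb0 : 0 ≤ b := by positivity
  -- The first summand bounds `D 0 / δ`, the second bounds `Z 0`; the factor `2` is that of
  -- `normE_add_le`.
  refine ⟨2 * (L * (b + 2 * (z / s)) / ε * κ' + z), fun δ hδ U V hU hV hUV => ?_⟩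
  set D : ℝ → E := fun t => U t - V t - δ • Z t with hD
  set g : ℝ → L2 := fun t => f (pos (U t)) - f (pos (V t))
    - δ • (f (pos (U₁ t)) - f (pos (V₁ t))) with hg
  have hforced := ((hU.isSolution.isForcedSolution hf.continuous).sub
    (hV.isSolution.isForcedSolution hf.continuous)).sub
    (((hU₁.isSolution.isForcedSolution hf.continuous).sub
      (hV₁.isSolution.isForcedSolution hf.continuous)).const_smul δ)
  have hmode : ∀ t < 0, ∀ k, HasModeDeriv ε k D (sinCoeff k (g t)) t := fun t ht k =>
    hforced.hasModeDeriv hε (fun t k => by ring) ht k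
  have hbd : ∃ C : ℝ, ∀ t ≤ 0, normE ε N (D t) ≤ C * Real.exp (η * t) := by
    refine exp_bound_sub h (exp_bound_sub h hU.bounded hV.bounded) ⟨δ * z, fun t ht => ?_⟩
    rw [normE_smul, abs_of_pos hδ, mul_assoc]
    exact mul_le_mul_of_nonneg_left (hz t ht) hδ.le
  have hzero : ∀ k ∈ Set.Icc 1 N, plusCoeff ε k (D 0) = 0 := fun k hk =>
    plusCoeff_eq_zero_of_mem_E2 hε (sub_mem hUV (Submodule.smul_mem _ δ h₁)) hk
  -- One `δ ‖pos (Z t)‖` comes from writing `U - V = D + δ Z`, the other from the subtracted term of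
  -- `g`.
  have hgle : ∀ B : ℝ, (∀ t ≤ 0, ‖pos (D t)‖ ≤ B * Real.exp (η * t)) →
      ∀ t ≤ 0, ‖g t‖ ≤ L * (B + 2 * δ * (z / s)) * Real.exp (η * t) := by
    intro B hB t ht
    have e1 : pos (U t) - pos (V t) = pos (D t) + δ • pos (Z t) := by
      have : U t - V t = D t + δ • Z t := by simp [hD]
      exact congrArg (fun W : E => pos W) this
    have l1 : ‖f (pos (U t)) - f (pos (V t))‖ ≤ L * (‖pos (D t)‖ + δ * ‖pos (Z t)‖) := by
      refine (hf.norm_sub_le _ _).trans (mul_le_mul_of_nonneg_left ?_ L.2)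
      rw [e1]
      refine (norm_add_le _ _).trans ?_
      rw [norm_smul, Real.norm_of_nonneg hδ.le]
    have l2 : ‖f (pos (U₁ t)) - f (pos (V₁ t))‖ ≤ L * ‖pos (Z t)‖ := hf.norm_sub_le _ _
    have l3 : ‖g t‖ ≤ ‖f (pos (U t)) - f (pos (V t))‖
        + δ * ‖f (pos (U₁ t)) - f (pos (V₁ t))‖ := by
      refine (norm_sub_le _ _).trans ?_
      rw [norm_smul, Real.norm_of_nonneg hδ.le]
    have l4 := mul_le_mul_of_nonneg_left l2 hδ.le
    have l5 : (L : ℝ) * (‖pos (D t)‖ + 2 * δ * ‖pos (Z t)‖) ≤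
        L * (B * Real.exp (η * t) + 2 * δ * (z / s * Real.exp (η * t))) := by
      have := hB t ht
      have := hposZ t ht
      gcongr
    linarith
  have hest : ∀ B : ℝ, (∀ t ≤ 0, ‖pos (D t)‖ ≤ B * Real.exp (η * t)) →
      ∀ t ≤ 0, normE ε N (D t) ≤
        L * (B + 2 * δ * (z / s)) / ε * κ' * Real.exp (η * t) := by
    intro B hB t ht
    obtain ⟨C, hC⟩ := hbd
    exact normE_le_of_hasModeDeriv hε h hη₁ hη₂ hforced.continuousOn hmode (hgle B hB) hC hzero ht
  have hexp : ∀ (t B : ℝ), ‖pos (D t)‖ * Real.exp (-(η * t)) ≤ B ↔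
      ‖pos (D t)‖ ≤ B * Real.exp (η * t) := by
    intro t B
    rw [Real.exp_neg, ← div_eq_mul_inv, div_le_iff₀ (Real.exp_pos _)]
  have hB : ∀ t ≤ 0, ‖pos (D t)‖ ≤ δ * b * Real.exp (η * t) := by
    obtain ⟨C, hC⟩ := hbd
    -- The iteration runs on the `L2` norm of the first component, where its factor is exactly the
    -- `κ` of the gap condition.
    have hiter := le_of_forall_bound_improves (ι := Iic (0 : ℝ))
      (x := fun t => ‖pos (D t)‖ * Real.exp (-(η * t))) (κ := κ) (b := κ * (2 * δ * (z / s)))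
      (B₀ := C / s) hgap ?_ ?_
    · intro t ht
      have h1 := (hexp t _).1 (hiter ⟨t, ht⟩)
      have h2 : κ * (2 * δ * (z / s)) / (1 - κ) = δ * b := by rw [hb]; ring
      rwa [h2] at h1
    · rintro ⟨t, ht⟩
      rw [hexp]
      refine (norm_pos_le h _).trans ?_
      rw [div_mul_eq_mul_div]
      exact div_le_div_of_nonneg_right (hC t ht) hs0.le
    · rintro B hB ⟨t, ht⟩
      rw [hexp]
      refine (norm_pos_le h _).trans ?_
      rw [div_le_iff₀ hs0]
      refine (hest B (fun t ht => (hexp t B).1 (hB ⟨t, ht⟩)) t ht).trans (le_of_eq ?_)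
      rw [hκ]
      field_simp
  have hD0 := hest _ hB 0 le_rfl
  rw [mul_zero, Real.exp_zero, mul_one] at hD0
  have hz1 : normE ε N (Z 0) ≤ z := by simpa using hz 0 le_rfl
  have hfin := normE_add_le h (D 0) (δ • Z 0)
  rw [normE_smul, abs_of_pos hδ] at hfin
  have e0 : D 0 + δ • Z 0 = U 0 - V 0 := by simp [hD]
  rw [e0] at hfin
  have hz2 := mul_le_mul_of_nonneg_left hz1 hδ.le
  have e2 : δ * (2 * (L * (b + 2 * (z / s)) / ε * κ' + z))
      = 2 * (L * (δ * b + 2 * δ * (z / s)) / ε * κ' + δ * z) := by ring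
  rw [e2]
  linarith

end

end DampedWave

/-! ### The almost sure comparison of the manifolds -/

open DampedWave in
theorem mainTheorem3
    (f : DampedWave.L2 → DampedWave.L2) (L : NNReal) (hf : LipschitzWith L f)
    (φ : DampedWave.H10)
    (N : ℕ) (hN : 1 ≤ N) (ε : ℝ) (hε : 0 < ε) (hεN : (N : ℝ) + 1 < 1 / (2 * ε))
    (η : ℝ) (hη₁ : DampedWave.lamPlus ε (N + 1) < η) (hη₂ : η < DampedWave.lamPlus ε N)
    (hgap : (L : ℝ) / √(1 / 4 - ε ^ 2 * ((N : ℝ) + 1) ^ 2) *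
      (1 / (DampedWave.lamPlus ε N - η) + 1 / (η - DampedWave.lamPlus ε (N + 1))) < 1)
    (ℙ : MeasureTheory.Measure DampedWave.Path) (hℙ : DampedWave.IsWienerMeasure ℙ)
    (S : Set DampedWave.Path) (hS : ∀ᵐ ω ∂ℙ, ω ∈ S)
    (hSinv : ∀ ω ∈ S, ∀ t : ℝ, DampedWave.shift t ω ∈ S)
    (h : ℝ → DampedWave.Path → DampedWave.E1 ε N → DampedWave.E2 ε N)
    (hM : ∀ δ : ℝ, 0 < δ → DampedWave.IsInertialManifold ε δ f φ N S
      (fun ω => DampedWave.lpManifold ε δ f φ N η ω) (h δ))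
    (h₀ : DampedWave.E1 ε N → DampedWave.E2 ε N)
    (hM₀ : DampedWave.IsInertialManifold ε 0 f φ N S
      (fun _ => DampedWave.lpManifold ε 0 f φ N η 0) (fun _ => h₀)) :
    ∀ᵐ ω ∂ℙ,
      (∀ R : ℝ, 0 < R → Filter.Tendsto
        (fun δ : ℝ => DampedWave.semiDist ε N (DampedWave.truncGraphE R (h δ ω))
          (DampedWave.lpManifold ε 0 f φ N η 0))
        (nhdsWithin 0 (Set.Ioi 0)) (nhds 0)) ∧
      ∃ c : ℝ, ∀ R : ℝ, 0 < R → ∀ δ : ℝ, 0 < δ →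
        DampedWave.semiDist ε N (DampedWave.truncGraphE R (h δ ω))
          (DampedWave.lpManifold ε 0 f φ N η 0) ≤ ENNReal.ofReal (δ * c) := by
  have hw := minWeight_pos hε hεN
  filter_upwards [hS] with ω hω
  have hsub : ∀ a b c : E, a + b - (a + c) = b - c := fun a b c => by abel
  -- The reference pair is taken over the base point `0` of `E₁`, before `R`, `δ` and `ξ` are
  -- chosen; hence `c` depends on none of them.
  obtain ⟨U₁, hU₁, hU₁0⟩ := exists_isBackwardSolution
    (((hM 1 one_pos).graph ω hω).ge ⟨0, rfl⟩ : _ ∈ lpManifold ε 1 f φ N η ω)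
  obtain ⟨V₁, hV₁, hV₁0⟩ := exists_isBackwardSolution
    ((hM₀.graph ω hω).ge ⟨0, rfl⟩ : _ ∈ lpManifold ε 0 f φ N η 0)
  obtain ⟨c, hc⟩ := exists_normE_sub_le hf hε hw hη₁ hη₂ hgap hU₁ hV₁ (by
    rw [hU₁0, hV₁0, hsub]
    exact sub_mem (h 1 ω 0).2 (h₀ 0).2)
  have hbound : ∀ R : ℝ, ∀ δ : ℝ, 0 < δ → semiDist ε N (truncGraphE R (h δ ω))
      (lpManifold ε 0 f φ N η 0) ≤ ENNReal.ofReal (δ * c) := by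
    intro R δ hδ
    refine iSup₂_le ?_
    rintro _ ⟨ξ, -, rfl⟩
    have hV₀ : (ξ : E) + (h₀ ξ : E) ∈ lpManifold ε 0 f φ N η 0 := (hM₀.graph ω hω).ge ⟨ξ, rfl⟩
    obtain ⟨U, hU, hU0⟩ := exists_isBackwardSolution
      (((hM δ hδ).graph ω hω).ge ⟨ξ, rfl⟩ : _ ∈ lpManifold ε δ f φ N η ω)
    obtain ⟨V, hV, hV0⟩ := exists_isBackwardSolution hV₀
    -- The point of `M₀` over the same `ξ` is a sufficient competitor in the infimum.
    refine (iInf₂_le _ hV₀).trans (ENNReal.ofReal_le_ofReal ?_)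
    rw [← hU0, ← hV0]
    refine hc δ hδ U V hU hV ?_
    rw [hU0, hV0, hsub]
    exact sub_mem (h δ ω ξ).2 (h₀ ξ).2
  refine ⟨fun R _ => ?_, c, fun R _ => hbound R⟩
  have hlim : Tendsto (fun δ : ℝ => ENNReal.ofReal (δ * c)) (𝓝[>] 0) (𝓝 0) := by
    have h1 : Tendsto (fun δ : ℝ => δ * c) (𝓝[>] 0) (𝓝 (0 * c)) :=
      (tendsto_id.mul_const c).mono_left nhdsWithin_le_nhds
    have h2 := ENNReal.tendsto_ofReal h1
    rwa [zero_mul, ENNReal.ofReal_zero] at h2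
  refine tendsto_of_tendsto_of_tendsto_of_le_of_le' tendsto_const_nhds hlim
    (Eventually.of_forall fun _ => zero_le) ?_
  filter_upwards [self_mem_nhdsWithin] with δ hδ
  exact hbound R δ hδ
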